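/- Let $\mathcal X^A$ and $\mathcal X^B$ be irreducible, time-homogeneous, continuous-time Markov chains on finite state spaces $\mathcal V^A=\mathcal S^A\cup\{1,2\}$ and $\mathcal V^B=\{1,2\}\cup\mathcal S^B$, where $1\ne 2$ and $\mathcal S^A,\mathcal S^B$ are disjoint finite (possibly empty) sets not containing $1,2$. Let $Q^A$, $Q^B$ be their transition rate matrices and $\pi^A$, $\pi^B$ their stationary distributions. The glued chain $\mathcal X$ on $\mathcal S^A\cup\{1,2\}\cup\mathcal S^B$ has the rate matrix $Q_{ij}=Q^A_{ij}\mathbf 1(i,j\in\mathcal V^A)+Q^B_{ij}\mathbf 1(i,j\in\mathcal V^B)$, and $\pi$ is its stationary distribution. For $\delta\in\{A,B\}$ and $\varepsilon'\in\{1,2\}$ let $\sigma^\delta_{\varepsilon'}$ be the first time at which $\mathcal X^\delta$ is in $\varepsilon'$ after having left its initial state, that is, $\sigma^\delta_{\varepsilon'}=\inf\{t>0:\ \exists u\in(0,t),\ \mathcal X^\delta_u\ne\varepsilon',\ \mathcal X^\delta_t=\varepsilon'\}$ if $\mathcal X^\delta_0=\varepsilon'$, and $\sigma^\delta_{\varepsilon'}=\inf\{t>0:\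 \mathcal X^\delta_t=\varepsilon'\}$ otherwise. For $\varepsilon,\varepsilon'\in\{1,2\}$ and $k\in\mathcal S^\delta$ put \[q^\delta_{\varepsilon\varepsilon'}=-Q^\delta_{\varepsilon\varepsilon}\,\mathrm P_\varepsilon(\sigma^\delta_{\varepsilon'}<\sigma^\delta_{3-\varepsilon'}),\qquad \chi^\delta_{\varepsilon'}(k)=\int_0^{\sigma^\delta_{\varepsilon'}}\mathbf 1(\mathcal X^\delta_t=k)\,dt,\qquad E^\delta_{\varepsilon\varepsilon'}(k)=\mathrm E_\varepsilon\big[\chi^\delta_{\varepsilon'}(k)\,\big|\,\sigma^\delta_{\varepsilon'}<\sigma^\delta_{3-\varepsilon'}\big],\] where $\mathrm P_\varepsilon,\mathrm E_\varepsilon$ refer to the chain started in $\varepsilon$ and the conditional expectation is taken to be $0$ if the condition has probability $0$. Let \[v_i=q^A_{11}E^A_{11}(i)+q^A_{12}E^A_{12}(i),\qquad w_i=q^A_{22}E^A_{22}(i)+q^A_{21}E^A_{21}(i)\qquad(i\in\mathcal S^A),\] \[x_j=q^B_{11}E^B_{11}(j)+q^B_{12}E^B_{12}(j),\qquad y_j=q^B_{22}E^B_{22}(j)+q^B_{21}E^B_{21}(j)\qquad(j\in\mathcal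 S^B).\] Theorem. Suppose that $\pi^A_1/\pi^A_2\ne\pi^B_1/\pi^B_2$. Then the numbers $v_i,w_i,x_j,y_j$ are finite, the four denominators below are nonzero, and for all $i\in\mathcal S^A$ and $j\in\mathcal S^B$ \[v_i=\frac{\pi^A_2\pi_i-\pi_2\pi^A_i}{\pi^A_2\pi_1-\pi_2\pi^A_1},\qquad w_i=\frac{\pi^A_1\pi_i-\pi_1\pi^A_i}{\pi^A_1\pi_2-\pi_1\pi^A_2},\qquad x_j=\frac{\pi^B_2\pi_j-\pi_2\pi^B_j}{\pi^B_2\pi_1-\pi_2\pi^B_1},\qquad y_j=\frac{\pi^B_1\pi_j-\pi_1\pi^B_j}{\pi^B_1\pi_2-\pi_1\pi^B_2}.\] Moreover, for all $i\in\mathcal S^A$ and $j\in\mathcal S^B$, \[\min\Big\{\frac{\pi_1}{\pi^A_1},\frac{\pi_2}{\pi^A_2}\Big\}\le\frac{\pi_i}{\pi^A_i}\le\max\Big\{\frac{\pi_1}{\pi^A_1},\frac{\pi_2}{\pi^A_2}\Big\},\qquad \min\Big\{\frac{\pi_1}{\pi^B_1},\frac{\pi_2}{\pi^B_2}\Big\}\le\frac{\pi_j}{\pi^B_j}\le\max\Big\{\frac{\pi_1}{\pi^B_1},\frac{\pi_2}{\pi^B_2}\Big\},\]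 and \[\min\Big\{\frac{\pi^A_1}{\pi^A_2},\frac{\pi^B_1}{\pi^B_2}\Big\}<\frac{\pi_1}{\pi_2}<\max\Big\{\frac{\pi^A_1}{\pi^A_2},\frac{\pi^B_1}{\pi^B_2}\Big\}.\] -/

import Mathlib

open scoped NNReal ENNReal

noncomputable section

namespace GluedChain

/-! A chain with two distinguished states has state space `S ⊕ Fin 2`: the elements `Sum.inr 0`
and `Sum.inr 1` are the states called `1` and `2` in the mathematics, and `S` is the (possibly
empty) finite set of all other states. -/

section Rates

variable {V : Type*}

/-- `Q` is a transition rate matrix: nonnegative off-diagonal entries and zero row sums, that is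
`Q i i = - ∑ j ≠ i, Q i j`. -/
structure IsRateMatrix [Fintype V] (Q : Matrix V V ℝ) : Prop where
  nonneg : ∀ i j, i ≠ j → 0 ≤ Q i j
  row_sum : ∀ i, ∑ j, Q i j = 0

/-- Irreducibility: every state is reachable from every other one by transitions of positive
rate. -/
def IsIrreducible (Q : Matrix V V ℝ) : Prop :=
  ∀ i j, Relation.ReflTransGen (fun a b => a ≠ b ∧ 0 < Q a b) i j

/-- `p` is a stationary distribution of the rate matrix `Q`. -/
structure IsStationary [Fintype V] (Q : Matrix V V ℝ) (p : V → ℝ) : Prop where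
  nonneg : ∀ i, 0 ≤ p i
  sum_eq_one : ∑ i, p i = 1
  vecMul_eq_zero : Matrix.vecMul p Q = 0

open Classical in
/-- Transition probability of the embedded jump chain (for a state `i` that is not absorbing). -/
def jumpProb (Q : Matrix V V ℝ) (i j : V) : ℝ :=
  if i = j then 0 else Q i j / (-Q i i)

end Rates

section Glue

variable {SA SB : Type*}

/-- The rate matrix of the glued chain on `(SA ⊕ SB) ⊕ Fin 2`: the two distinguished states of
either chain are identified, all transitions are kept, and the rates between the two
distinguished states add up. -/
def glue (QA : Matrix (SA ⊕ Fin 2) (SA ⊕ Fin 2) ℝ) (QB : Matrix (SB ⊕ Fin 2) (SB ⊕ Fin 2) ℝ) :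
    Matrix ((SA ⊕ SB) ⊕ Fin 2) ((SA ⊕ SB) ⊕ Fin 2) ℝ
  | .inl (.inl i), .inl (.inl j) => QA (.inl i) (.inl j)
  | .inl (.inl _), .inl (.inr _) => 0
  | .inl (.inl i), .inr e => QA (.inl i) (.inr e)
  | .inl (.inr _), .inl (.inl _) => 0
  | .inl (.inr i), .inl (.inr j) => QB (.inl i) (.inl j)
  | .inl (.inr i), .inr e => QB (.inl i) (.inr e)
  | .inr e, .inl (.inl j) => QA (.inr e) (.inl j)
  | .inr e, .inl (.inr j) => QB (.inr e) (.inl j)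
  | .inr e, .inr e' => QA (.inr e) (.inr e') + QB (.inr e) (.inr e')

end Glue

section Chain

variable {V Ω : Type*} [MeasurableSpace Ω]

open Classical in
/-- Under the probability measure `P`, the process `X` is a time-homogeneous continuous-time
Markov chain with rate matrix `Q` and initial state `x`. This is the description by jump chain
and holding times: `X` visits the states `Y 0, Y 1, …`, staying in `Y n` for the time `S n`;
`Y` is a Markov chain started in `x` with transition probabilities `jumpProb Q`, and given `Y` the
holding times are independent, `S n` being exponential with parameter `-Q (Y n) (Y n)`.
(On a finite state space almost surely `∑ S n = ∞`, so `X` is thereby determined almost surely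
at all times. The matrix `Q` is supposed to have no absorbing state.) -/
structure IsMarkovJumpProcess (Q : Matrix V V ℝ) (x : V) (P : MeasureTheory.Measure Ω)
    (X : ℝ≥0 → Ω → V) : Prop where
  isProbability : MeasureTheory.IsProbabilityMeasure P
  measurableSet_eq : ∀ t i, MeasurableSet {ω | X t ω = i}
  exists_jump_hold : ∃ (Y : ℕ → Ω → V) (S : ℕ → Ω → ℝ≥0),
    (∀ n i, MeasurableSet {ω | Y n ω = i}) ∧ (∀ n, Measurable (S n)) ∧
    (∀ᵐ ω ∂P, ∀ (n : ℕ) (t : ℝ≥0), ∑ m ∈ Finset.range n, S m ω ≤ t →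
      t < ∑ m ∈ Finset.range (n + 1), S m ω → X t ω = Y n ω) ∧
    ∀ (n : ℕ) (i : ℕ → V) (t : ℕ → ℝ≥0),
      P {ω | ∀ m ≤ n, Y m ω = i m ∧ t m < S m ω} =
        ENNReal.ofReal ((if i 0 = x then 1 else 0)
          * (∏ m ∈ Finset.range n, jumpProb Q (i m) (i (m + 1)))
          * ∏ m ∈ Finset.range (n + 1), Real.exp (Q (i m) (i m) * t m))

open Classical in
/-- For a path `γ`, the first time (possibly `∞`) at which `γ` is in state `a` after having left
its initial state. -/
def hitTime (γ : ℝ≥0 → V) (a : V) : ℝ≥0∞ :=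
  if γ 0 = a then
    ⨅ t ∈ {t : ℝ≥0 | 0 < t ∧ (∃ u, 0 < u ∧ u < t ∧ γ u ≠ a) ∧ γ t = a}, (t : ℝ≥0∞)
  else
    ⨅ t ∈ {t : ℝ≥0 | 0 < t ∧ γ t = a}, (t : ℝ≥0∞)

open Classical in
/-- The time `∫_0^{σ_a} 1(γ_t = k) dt` spent by the path `γ` in state `k` before `σ_a`. -/
def occupation (γ : ℝ≥0 → V) (a k : V) : ℝ≥0∞ :=
  ∫⁻ t in {t : ℝ | 0 ≤ t ∧ ENNReal.ofReal t < hitTime γ a}, if γ t.toNNReal = k then 1 else 0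

end Chain

section Excursions

variable {S Ω : Type*} [MeasurableSpace Ω]

/-- The event `σ_{e'} < σ_{3-e'}`: the first of the two distinguished states that is entered
after leaving the initial state is `e'` (`e'.rev` is the other distinguished state). -/
def exitEvent (X : ℝ≥0 → Ω → S ⊕ Fin 2) (e' : Fin 2) : Set Ω :=
  {ω | hitTime (fun t => X t ω) (.inr e') < hitTime (fun t => X t ω) (.inr e'.rev)}

/-- The intensity with which the chain leaves `e` on an excursion that ends in `e'`: the total
rate of leaving `e` times the probability of that type of excursion. The measure `P e` is the
law under which `X` is started from the distinguished state `e`. -/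
def excursionRate (Q : Matrix (S ⊕ Fin 2) (S ⊕ Fin 2) ℝ) (P : Fin 2 → MeasureTheory.Measure Ω)
    (X : ℝ≥0 → Ω → S ⊕ Fin 2) (e e' : Fin 2) : ℝ≥0∞ :=
  ENNReal.ofReal (-Q (.inr e) (.inr e)) * P e (exitEvent X e')

open Classical in
/-- The conditional expectation `E_e[χ_{e'}(k) | σ_{e'} < σ_{3-e'}]` of the time spent in `k` on an
excursion from `e` that ends in `e'`; zero if the condition has probability zero. -/
def condOccupation (P : Fin 2 → MeasureTheory.Measure Ω)
    (X : ℝ≥0 → Ω → S ⊕ Fin 2) (e e' : Fin 2) (k : S) : ℝ≥0∞ :=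
  if P e (exitEvent X e') ≠ 0 then
    (∫⁻ ω, (exitEvent X e').indicator
      (fun ω => occupation (fun t => X t ω) (.inr e') (.inl k)) ω ∂(P e)) / P e (exitEvent X e')
  else 0

/-- The sum over both possible final states `e'` of the intensity of excursions from `e` to `e'`
times the expected time spent in `k` on such an excursion. For the first chain this is `v k`
(`e = 0`) and `w k` (`e = 1`), for the second one `x k` (`e = 0`) and `y k` (`e = 1`). It is
`ℝ≥0∞`-valued, as its finiteness is part of what is to be proved. -/
def excursionWeight (Q : Matrix (S ⊕ Fin 2) (S ⊕ Fin 2) ℝ) (P : Fin 2 → MeasureTheory.Measure Ω)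
    (X : ℝ≥0 → Ω → S ⊕ Fin 2) (e : Fin 2) (k : S) : ℝ≥0∞ :=
  ∑ e' : Fin 2, excursionRate Q P X e e' * condOccupation P X e e' k

end Excursions

end GluedChain

end

/-!
The whole theorem rests on one identification: for each of the two chains and each distinguished
state `e`, the excursion weights `v e` are finite and form a nonnegative solution of
`v e Q_SS = -Q_eS`, where `S` is the set of the other states. Everything after that is linear
algebra.

*The identification.* In terms of the jump chain and the holding times, `v e k` is `-Q e e` times
the expected number of visits to `k` before the return to the distinguished states, times the mean
holding time `1 / (-Q k k)`. The Markov property of the jump chain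
(`IsJumpHold.measure_mem_history_succ`) yields a first-step equation for the expected numbers of
visits (`IsJumpHold.greenMass_eq`), which becomes the balance equation. They are finite because
their partial sums stay below a supersolution of the first-step equation built from the stationary
distribution (`IsJumpHold.greenMass_le`); this also shows that the return happens almost surely.
Explosion of the jump chain need not be excluded: up to the almost surely finite number of
steps to the return, the path is determined by the holding times (`IsStepPath.occupation_eq`,
`indicator_exitEvent_eq`).

*The formulas.* By irreducibility `Q_SS` has trivial left kernel (`eq_zero_of_killed_balance`), so
any vector `p` in balance on `S` satisfies `p k = p 1 * v 1 k + p 2 * v 2 k`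
(`eq_add_of_balance`, with `1`, `2` the distinguished states). Both the stationary distribution of
the part and the restriction of that of the glued chain are in balance on `S`. Solving the two
linear equations gives the formulas, and nonnegativity of `v` gives the bounds.

*The strict bounds.* Eliminating `S`, each part acts on the distinguished states through effective
rates `a 1 2`, `a 2 1`, positive by irreducibility, and its stationary ratio is `a 2 1 / a 1 2`
(`IsStationary.div_eq`). The effective rates of the two parts add up in the glued chain, so its
ratio is the mediant of the two ratios and lies strictly between them
(`mediant_strictly_between`). In particular it differs from both, which is why the denominators do
not vanish.
-/

namespace GluedChain

/-! ### Irreducible rate matrices and their stationary distributions -/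

section Rates

variable {V : Type*} {Q : Matrix V V ℝ}

lemma IsIrreducible.of_closed (h : IsIrreducible Q) {R : V → Prop}
    (hR : ∀ a b, R a → a ≠ b → 0 < Q a b → R b) {i : V} (hi : R i) (j : V) : R j := by
  have hij := h i j
  induction hij with
  | refl => exact hi
  | tail _ hbc ih => exact hR _ _ ih hbc.1 hbc.2

variable [Fintype V]

lemma IsRateMatrix.diag_neg [Nontrivial V] (hQ : IsRateMatrix Q) (h : IsIrreducible Q) (i : V) :
    Q i i < 0 := by
  classical
  by_contra! hi
  have hnn : ∀ j ∈ Finset.univ, 0 ≤ Q i j := fun j _ => by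
    by_cases hij : i = j
    · subst hij; exact hi
    · exact hQ.nonneg i j hij
  have h0 := (Finset.sum_eq_zero_iff_of_nonneg hnn).1 (hQ.row_sum i)
  obtain ⟨j, hj⟩ := exists_ne i
  refine hj (h.of_closed (R := fun a => a = i) ?_ rfl j)
  rintro a b rfl - hab
  rw [h0 b (Finset.mem_univ _)] at hab
  exact absurd hab (lt_irrefl _)

lemma IsStationary.pos (hQ : IsRateMatrix Q) (h : IsIrreducible Q) {p : V → ℝ}
    (hp : IsStationary Q p) (i : V) : 0 < p i := by
  obtain ⟨i₀, hi₀⟩ : ∃ i, 0 < p i := by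
    by_contra! hc
    have := Finset.sum_nonpos (s := Finset.univ) fun i _ => hc i
    rw [hp.sum_eq_one] at this
    linarith
  refine h.of_closed (R := fun a => 0 < p a) ?_ hi₀ i
  intro a b ha hab hQab
  by_contra hb
  have hb0 : p b = 0 := le_antisymm (not_lt.1 hb) (hp.nonneg b)
  have hsum : ∑ c, p c * Q c b = 0 := congrFun hp.vecMul_eq_zero b
  have hnn : ∀ c ∈ Finset.univ, 0 ≤ p c * Q c b := fun c _ => by
    by_cases hcb : c = b
    · simp [hcb, hb0]
    · exact mul_nonneg (hp.nonneg c) (hQ.nonneg c b hcb)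
  have := (Finset.sum_eq_zero_iff_of_nonneg hnn).1 hsum a (Finset.mem_univ _)
  have := mul_pos ha hQab
  linarith

lemma jumpProb_nonneg (hQ : IsRateMatrix Q) {i : V} (hi : Q i i < 0) (j : V) :
    0 ≤ jumpProb Q i j := by
  unfold jumpProb
  split_ifs with h
  · exact le_rfl
  · exact div_nonneg (hQ.nonneg i j h) (by linarith)

lemma sum_jumpProb (hQ : IsRateMatrix Q) {i : V} (hi : Q i i < 0) :
    ∑ j, jumpProb Q i j = 1 := by
  classical
  have h := hQ.row_sum i
  rw [← Finset.add_sum_erase _ _ (Finset.mem_univ i)] at h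
  rw [← Finset.add_sum_erase _ _ (Finset.mem_univ i)]
  have h1 : ∀ j ∈ Finset.univ.erase i, jumpProb Q i j = Q i j / (-Q i i) := fun j hj => by
    simp [jumpProb, (Finset.ne_of_mem_erase hj).symm]
  rw [Finset.sum_congr rfl h1, ← Finset.sum_div]
  have h2 : ∑ j ∈ Finset.univ.erase i, Q i j = -Q i i := by linarith
  rw [h2, div_self (by linarith)]
  simp [jumpProb]

lemma IsStationary.sum_mul_jumpProb {p : V → ℝ} (hneg : ∀ i, Q i i < 0) (hp : IsStationary Q p)
    (k : V) : ∑ i, p i * -Q i i * jumpProb Q i k = p k * -Q k k := by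
  classical
  have h1 : ∑ i, p i * Q i k = 0 := congrFun hp.vecMul_eq_zero k
  rw [← Finset.add_sum_erase _ _ (Finset.mem_univ k)] at h1 ⊢
  have h2 : ∀ i ∈ Finset.univ.erase k, p i * -Q i i * jumpProb Q i k = p i * Q i k := by
    intro i hi
    rw [jumpProb, if_neg (Finset.ne_of_mem_erase hi), mul_assoc, mul_div_cancel₀]
    exact (neg_pos.2 (hneg i)).ne'
  rw [Finset.sum_congr rfl h2]
  simp only [jumpProb, if_true, mul_zero, zero_add]
  linarith

end Rates

/-! ### Excursion weights as solutions of a linear system -/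

section Excursion

variable {S : Type*} [Fintype S] {Q : Matrix (S ⊕ Fin 2) (S ⊕ Fin 2) ℝ}

/-- `v` is a nonnegative solution of the balance equations at the non-distinguished states, with
unit mass at the distinguished state `e` and no mass at the other one. -/
structure IsExcursionSolution (Q : Matrix (S ⊕ Fin 2) (S ⊕ Fin 2) ℝ) (e : Fin 2) (v : S → ℝ) :
    Prop where
  nonneg : ∀ k, 0 ≤ v k
  balance : ∀ k, Q (.inr e) (.inl k) + ∑ l, v l * Q (.inl l) (.inl k) = 0

/-- The total rate of passing from the distinguished state `e` to the distinguished state `e'`,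
directly or through an excursion with weights `v`. -/
def effectiveRate (Q : Matrix (S ⊕ Fin 2) (S ⊕ Fin 2) ℝ) (e e' : Fin 2) (v : S → ℝ) : ℝ :=
  Q (.inr e) (.inr e') + ∑ k, v k * Q (.inl k) (.inr e')

/-- The rate matrix killed at the distinguished states has trivial left kernel: otherwise the
support of a kernel element would be a set which the chain never leaves. -/
lemma eq_zero_of_killed_balance (hQ : IsRateMatrix Q) (h : IsIrreducible Q) {d : S → ℝ}
    (hd : ∀ k, ∑ l, d l * Q (.inl l) (.inl k) = 0) (k : S) : d k = 0 := by
  classical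
  -- `|d|` is subharmonic: no column sum of `|d| Q` is negative.
  have hcol : ∀ k, 0 ≤ ∑ l, |d l| * Q (.inl l) (.inl k) := by
    intro k
    have h1 := hd k
    rw [← Finset.add_sum_erase _ _ (Finset.mem_univ k)] at h1 ⊢
    have hnn : ∀ l ∈ Finset.univ.erase k, 0 ≤ Q (.inl l) (.inl k) := fun l hl =>
      hQ.nonneg _ _ (by simpa using Finset.ne_of_mem_erase hl)
    have h2 : |∑ l ∈ Finset.univ.erase k, d l * Q (.inl l) (.inl k)| ≤
        ∑ l ∈ Finset.univ.erase k, |d l| * Q (.inl l) (.inl k) := by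
      refine (Finset.abs_sum_le_sum_abs _ _).trans (Finset.sum_le_sum fun l hl => ?_)
      rw [abs_mul, abs_of_nonneg (hnn l hl)]
    have h3 : |d k| * Q (.inl k) (.inl k) ≥ -|d k * Q (.inl k) (.inl k)| := by
      rw [abs_mul, ← mul_neg]
      exact mul_le_mul_of_nonneg_left (neg_abs_le _) (abs_nonneg _)
    have h4 : |d k * Q (.inl k) (.inl k)| =
        |∑ l ∈ Finset.univ.erase k, d l * Q (.inl l) (.inl k)| := by
      rw [eq_neg_of_add_eq_zero_left h1, abs_neg]
    linarith
  -- Summing the columns, the row sums turn this into a bound for the rates of leaving `S`.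
  have hrow : ∀ l : S, ∑ k : S, Q (.inl l) (.inl k) =
      -(Q (.inl l) (.inr 0) + Q (.inl l) (.inr 1)) := fun l => by
    have := hQ.row_sum (.inl l)
    rw [Fintype.sum_sum_type, Fin.sum_univ_two] at this
    linarith
  have hswap : ∑ k : S, ∑ l : S, |d l| * Q (.inl l) (.inl k) =
      -∑ l : S, |d l| * (Q (.inl l) (.inr 0) + Q (.inl l) (.inr 1)) := by
    rw [Finset.sum_comm, ← Finset.sum_neg_distrib]
    refine Finset.sum_congr rfl fun l _ => ?_
    rw [← Finset.mul_sum, hrow]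
    ring
  have hq : ∀ (l : S) (e : Fin 2), 0 ≤ Q (.inl l) (.inr e) := fun l e => hQ.nonneg _ _ (by simp)
  have hexit_nn : ∀ l ∈ Finset.univ,
      0 ≤ |d l| * (Q (.inl l) (.inr 0) + Q (.inl l) (.inr 1)) := fun l _ =>
    mul_nonneg (abs_nonneg _) (add_nonneg (hq l 0) (hq l 1))
  have htot : 0 ≤ ∑ k : S, ∑ l : S, |d l| * Q (.inl l) (.inl k) :=
    Finset.sum_nonneg fun k _ => hcol k
  have hexit0 : ∑ l : S, |d l| * (Q (.inl l) (.inr 0) + Q (.inl l) (.inr 1)) = 0 :=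
    le_antisymm (by linarith) (Finset.sum_nonneg hexit_nn)
  have hexit := (Finset.sum_eq_zero_iff_of_nonneg hexit_nn).1 hexit0
  have hcol0 := (Finset.sum_eq_zero_iff_of_nonneg fun k _ => hcol k).1
    (by rw [hswap, hexit0, neg_zero])
  by_contra hk
  have key := h.of_closed (R := fun a => ∃ l, a = .inl l ∧ d l ≠ 0) ?_ (i := .inl k) ⟨k, rfl, hk⟩
    (.inr 0)
  · obtain ⟨l, hl, -⟩ := key
    simp at hl
  rintro _ b ⟨l, rfl, hl⟩ hab hpos
  have hlpos : 0 < |d l| := abs_pos.2 hl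
  have h0 := hexit l (Finset.mem_univ _)
  rcases b with m | e
  · refine ⟨m, rfl, fun hm => ?_⟩
    have hs := hcol0 m (Finset.mem_univ _)
    have hnn : ∀ c ∈ Finset.univ, 0 ≤ |d c| * Q (.inl c) (.inl m) := fun c _ => by
      by_cases hcm : c = m
      · simp [hcm, hm]
      · exact mul_nonneg (abs_nonneg _) (hQ.nonneg _ _ (by simpa using hcm))
    have := (Finset.sum_eq_zero_iff_of_nonneg hnn).1 hs l (Finset.mem_univ _)
    have := mul_pos hlpos hpos
    linarith
  · exfalso
    have h1 : Q (.inl l) (.inr 0) + Q (.inl l) (.inr 1) = 0 :=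
      (mul_eq_zero.1 h0).resolve_left hlpos.ne'
    have := hq l 0
    have := hq l 1
    fin_cases e <;> simp only [Fin.zero_eta, Fin.mk_one] at hpos <;> linarith

/-- A vector in balance at the non-distinguished states is determined by its two values at the
distinguished states. -/
lemma eq_add_of_balance (hQ : IsRateMatrix Q) (h : IsIrreducible Q) {v : Fin 2 → S → ℝ}
    (hv : ∀ e, IsExcursionSolution Q e (v e)) {p : S ⊕ Fin 2 → ℝ}
    (hp : ∀ k : S, ∑ i, p i * Q i (.inl k) = 0) (k : S) :
    p (.inl k) = p (.inr 0) * v 0 k + p (.inr 1) * v 1 k := by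
  have := eq_zero_of_killed_balance hQ h
    (d := fun k => p (.inl k) - (p (.inr 0) * v 0 k + p (.inr 1) * v 1 k)) (fun k => ?_) k
  · exact sub_eq_zero.1 this
  have h1 := hp k
  rw [Fintype.sum_sum_type, Fin.sum_univ_two] at h1
  have h2 := (hv 0).balance k
  have h3 := (hv 1).balance k
  simp only [sub_mul, add_mul, Finset.sum_sub_distrib, Finset.sum_add_distrib, mul_assoc,
    ← Finset.mul_sum]
  linear_combination h1 - p (.inr 0) * h2 - p (.inr 1) * h3

lemma flux_eq (hQ : IsRateMatrix Q) (h : IsIrreducible Q) {v : Fin 2 → S → ℝ}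
    (hv : ∀ e, IsExcursionSolution Q e (v e)) {p : S ⊕ Fin 2 → ℝ}
    (hp : ∀ k : S, ∑ i, p i * Q i (.inl k) = 0) (e' : Fin 2) :
    ∑ i, p i * Q i (.inr e') =
      p (.inr 0) * effectiveRate Q 0 e' (v 0) + p (.inr 1) * effectiveRate Q 1 e' (v 1) := by
  rw [Fintype.sum_sum_type, Fin.sum_univ_two]
  simp only [eq_add_of_balance hQ h hv hp, effectiveRate, add_mul, mul_add,
    Finset.sum_add_distrib, mul_assoc, ← Finset.mul_sum]
  ring

lemma IsExcursionSolution.effectiveRate_add (hQ : IsRateMatrix Q) {e : Fin 2} {v : S → ℝ}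
    (hv : IsExcursionSolution Q e v) : effectiveRate Q e 0 v + effectiveRate Q e 1 v = 0 := by
  have h1 := hQ.row_sum (.inr e)
  rw [Fintype.sum_sum_type, Fin.sum_univ_two] at h1
  have h2 : ∑ k, (Q (.inr e) (.inl k) + ∑ l, v l * Q (.inl l) (.inl k)) = 0 :=
    Finset.sum_eq_zero fun k _ => hv.balance k
  rw [Finset.sum_add_distrib, Finset.sum_comm] at h2
  have h3 : ∑ l : S, ∑ k : S, v l * Q (.inl l) (.inl k) =
      -(∑ l, v l * Q (.inl l) (.inr 0) + ∑ l, v l * Q (.inl l) (.inr 1)) := by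
    rw [← Finset.sum_add_distrib, ← Finset.sum_neg_distrib]
    refine Finset.sum_congr rfl fun l _ => ?_
    have := hQ.row_sum (.inl l)
    rw [Fintype.sum_sum_type, Fin.sum_univ_two] at this
    rw [← Finset.mul_sum]
    linear_combination v l * this
  rw [h3] at h2
  unfold effectiveRate
  linarith

/-- If the effective rate vanished, `e` together with the support of `v` would be a set which the
chain never leaves. -/
lemma IsExcursionSolution.effectiveRate_pos (hQ : IsRateMatrix Q) (h : IsIrreducible Q)
    {e e' : Fin 2} (hee' : e ≠ e') {v : S → ℝ} (hv : IsExcursionSolution Q e v) :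
    0 < effectiveRate Q e e' v := by
  classical
  have hnn : ∀ k ∈ Finset.univ, 0 ≤ v k * Q (.inl k) (.inr e') := fun k _ =>
    mul_nonneg (hv.nonneg k) (hQ.nonneg _ _ (by simp))
  have hq : 0 ≤ Q (.inr e) (.inr e') := hQ.nonneg _ _ (by simpa using hee')
  by_contra! hle
  unfold effectiveRate at hle
  have hs := Finset.sum_nonneg hnn
  have hs0 := (Finset.sum_eq_zero_iff_of_nonneg hnn).1 (by linarith)
  have hq0 : Q (.inr e) (.inr e') = 0 := by linarith
  have key := h.of_closed (R := fun a => a = .inr e ∨ ∃ l, a = .inl l ∧ 0 < v l) ?_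
    (Or.inl rfl) (.inr e')
  · rcases key with h1 | ⟨l, hl, -⟩
    · exact hee' (by simpa using h1.symm)
    · simp at hl
  have hcol : ∀ m l : S, l ≠ m → 0 ≤ v l * Q (.inl l) (.inl m) := fun m l hlm =>
    mul_nonneg (hv.nonneg l) (hQ.nonneg _ _ (by simpa using hlm))
  have hinl : ∀ m : S, (0 < Q (.inr e) (.inl m) ∨ ∃ l, 0 < v l ∧ 0 < Q (.inl l) (.inl m)) →
      0 < v m := by
    intro m hm
    by_contra hvm
    have hvm0 : v m = 0 := le_antisymm (not_lt.1 hvm) (hv.nonneg m)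
    have hcnn : ∀ l ∈ Finset.univ, 0 ≤ v l * Q (.inl l) (.inl m) := fun l _ => by
      by_cases hlm : l = m
      · simp [hlm, hvm0]
      · exact hcol m l hlm
    have hb := hv.balance m
    have hem : 0 ≤ Q (.inr e) (.inl m) := hQ.nonneg _ _ (by simp)
    have hsn := Finset.sum_nonneg hcnn
    rcases hm with hm | ⟨l, hl, hlm⟩
    · linarith
    · have := (Finset.sum_eq_zero_iff_of_nonneg hcnn).1 (by linarith) l (Finset.mem_univ _)
      have := mul_pos hl hlm
      linarith
  have hinr : ∀ f : Fin 2, f ≠ e → f = e' := by omega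
  rintro a (m | f) ha hab hpos
  · right
    refine ⟨m, rfl, hinl m ?_⟩
    rcases ha with rfl | ⟨l, rfl, hl⟩
    · exact Or.inl hpos
    · exact Or.inr ⟨l, hl, hpos⟩
  · by_cases hf : f = e
    · left; rw [hf]
    · exfalso
      obtain rfl := hinr f hf
      rcases ha with rfl | ⟨l, rfl, hl⟩
      · linarith
      · have := hs0 l (Finset.mem_univ _)
        have := mul_pos hl hpos
        linarith

end Excursion

end GluedChain

namespace GluedChain

/-! ### Hitting and occupation times of a step path -/

section Path

variable {V : Type*} {γ : ℝ≥0 → V} {y : ℕ → V} {s : ℕ → ℝ≥0}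

/-- `γ` visits the states `y 0, y 1, …` one after the other, staying in `y n` for the positive time
`s n`. Nothing is said about `γ` after the explosion time `∑ s n`, if that is finite. -/
structure IsStepPath (γ : ℝ≥0 → V) (y : ℕ → V) (s : ℕ → ℝ≥0) : Prop where
  pos : ∀ n, 0 < s n
  eq : ∀ (n : ℕ) (t : ℝ≥0), ∑ m ∈ Finset.range n, s m ≤ t →
    t < ∑ m ∈ Finset.range (n + 1), s m → γ t = y n

lemma exists_step {t : ℝ≥0} {M : ℕ} (ht : t < ∑ m ∈ Finset.range M, s m) :
    ∃ n < M, ∑ m ∈ Finset.range n, s m ≤ t ∧ t < ∑ m ∈ Finset.range (n + 1), s m := by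
  induction M with
  | zero => simp at ht
  | succ M ih =>
    by_cases h : t < ∑ m ∈ Finset.range M, s m
    · obtain ⟨n, hn, h'⟩ := ih h
      exact ⟨n, hn.trans (Nat.lt_succ_self _), h'⟩
    · exact ⟨M, Nat.lt_succ_self _, not_lt.1 h, ht⟩

namespace IsStepPath

lemma sum_lt (h : IsStepPath γ y s) {m n : ℕ} (hmn : m < n) :
    ∑ j ∈ Finset.range m, s j < ∑ j ∈ Finset.range n, s j := by
  have : StrictMono fun n => ∑ j ∈ Finset.range n, s j :=
    strictMono_nat_of_lt_succ fun n => by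
      rw [Finset.sum_range_succ]
      exact lt_add_of_pos_right _ (h.pos n)
  exact this hmn

lemma apply_sum (h : IsStepPath γ y s) (n : ℕ) : γ (∑ j ∈ Finset.range n, s j) = y n :=
  h.eq n _ le_rfl (h.sum_lt (Nat.lt_succ_self n))

lemma apply_zero (h : IsStepPath γ y s) : γ 0 = y 0 := by simpa using h.apply_sum 0

lemma le_hitTime (h : IsStepPath γ y s) {a : V} {M : ℕ} (ha : ∀ j, 0 < j → j < M → y j ≠ a) :
    ((∑ j ∈ Finset.range M, s j : ℝ≥0) : ℝ≥0∞) ≤ hitTime γ a := by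
  unfold hitTime
  rw [h.apply_zero]
  split_ifs with h0
  · refine le_iInf₂ fun t ht => ENNReal.coe_le_coe.2 ?_
    obtain ⟨ht0, ⟨u, hu0, hut, hua⟩, hta⟩ := ht
    by_contra! hlt
    obtain ⟨n, hn, h1, h2⟩ := exists_step hlt
    have hn0 : n = 0 := by
      by_contra hne
      exact ha n (Nat.pos_of_ne_zero hne) hn ((h.eq n t h1 h2).symm.trans hta)
    subst hn0
    -- up to its first jump, the path has not left its initial state
    exact hua ((h.eq 0 u (by simp) (hut.trans h2)).trans h0)
  · refine le_iInf₂ fun t ht => ENNReal.coe_le_coe.2 ?_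
    obtain ⟨ht0, hta⟩ := ht
    by_contra! hlt
    obtain ⟨n, hn, h1, h2⟩ := exists_step hlt
    have hna : y n = a := (h.eq n t h1 h2).symm.trans hta
    rcases Nat.eq_zero_or_pos n with rfl | hpos
    · exact h0 hna
    · exact ha n hpos hn hna

lemma hitTime_le (h : IsStepPath γ y s) (h01 : y 1 ≠ y 0) {a : V} {N : ℕ} (hN : 0 < N)
    (hNa : y N = a) : hitTime γ a ≤ ((∑ j ∈ Finset.range N, s j : ℝ≥0) : ℝ≥0∞) := by
  have hpos : 0 < ∑ j ∈ Finset.range N, s j := by simpa using h.sum_lt hN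
  unfold hitTime
  rw [h.apply_zero]
  split_ifs with h0
  · refine iInf₂_le _ ⟨hpos, ⟨∑ j ∈ Finset.range 1, s j, ?_, ?_, ?_⟩, ?_⟩
    · simpa using h.pos 0
    · refine h.sum_lt (lt_of_le_of_ne hN ?_)
      rintro rfl
      exact h01 (hNa.trans h0.symm)
    · rw [h.apply_sum, ← h0]
      exact h01
    · rw [h.apply_sum, hNa]
  · exact iInf₂_le _ ⟨hpos, by rw [h.apply_sum, hNa]⟩

lemma hitTime_eq (h : IsStepPath γ y s) (h01 : y 1 ≠ y 0) {a : V} {N : ℕ} (hN : 0 < N)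
    (hNa : y N = a) (ha : ∀ j, 0 < j → j < N → y j ≠ a) :
    hitTime γ a = ((∑ j ∈ Finset.range N, s j : ℝ≥0) : ℝ≥0∞) :=
  le_antisymm (h.hitTime_le h01 hN hNa) (h.le_hitTime ha)

open Classical in
lemma lintegral_Ico_eq_sum (h : IsStepPath γ y s) (k : V) (N : ℕ) :
    ∫⁻ t in Set.Ico (0 : ℝ) (∑ j ∈ Finset.range N, s j : ℝ≥0),
      (if γ t.toNNReal = k then (1 : ℝ≥0∞) else 0) =
    ∑ j ∈ Finset.range N, if y j = k then (s j : ℝ≥0∞) else 0 := by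
  induction N with
  | zero => simp
  | succ N ih =>
    have hle : (∑ j ∈ Finset.range N, s j) ≤ ∑ j ∈ Finset.range (N + 1), s j :=
      (h.sum_lt (Nat.lt_succ_self N)).le
    rw [← Set.Ico_union_Ico_eq_Ico (NNReal.coe_nonneg (∑ j ∈ Finset.range N, s j))
        (NNReal.coe_le_coe.2 hle),
      MeasureTheory.lintegral_union measurableSet_Ico
        (Set.disjoint_left.2 fun t h1 h2 => absurd h1.2 (not_lt.2 h2.1)),
      ih, Finset.sum_range_succ (fun j => if y j = k then (s j : ℝ≥0∞) else 0) N]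
    congr 1
    have hconst : ∀ t ∈ Set.Ico ((∑ j ∈ Finset.range N, s j : ℝ≥0) : ℝ)
        ((∑ j ∈ Finset.range (N + 1), s j : ℝ≥0) : ℝ),
        (if γ t.toNNReal = k then (1 : ℝ≥0∞) else 0) = if y N = k then 1 else 0 := by
      intro t ht
      have ht0 : 0 ≤ t := (NNReal.coe_nonneg _).trans ht.1
      rw [h.eq N t.toNNReal (NNReal.le_toNNReal_of_coe_le ht.1)
        ((Real.toNNReal_lt_iff_lt_coe ht0).2 ht.2)]
    rw [MeasureTheory.setLIntegral_congr_fun measurableSet_Ico hconst,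
      MeasureTheory.setLIntegral_const, Real.volume_Ico, Finset.sum_range_succ, NNReal.coe_add,
      add_sub_cancel_left, ENNReal.ofReal_coe_nnreal]
    split_ifs <;> simp

open Classical in
lemma occupation_eq (h : IsStepPath γ y s) (h01 : y 1 ≠ y 0) {a : V} {N : ℕ} (hN : 0 < N)
    (hNa : y N = a) (ha : ∀ j, 0 < j → j < N → y j ≠ a) (k : V) :
    occupation γ a k = ∑ j ∈ Finset.range N, if y j = k then (s j : ℝ≥0∞) else 0 := by
  rw [← h.lintegral_Ico_eq_sum k N, occupation, h.hitTime_eq h01 hN hNa ha]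
  congr 2
  ext t
  simp only [Set.mem_ofPred_eq, Set.mem_Ico]
  refine and_congr_right fun ht => ?_
  rw [← ENNReal.ofReal_coe_nnreal, ENNReal.ofReal_lt_ofReal_iff_of_nonneg ht]

end IsStepPath

end Path

end GluedChain

namespace GluedChain

/-! ### The law of the jump chain and the holding times -/

section JumpHold

open MeasureTheory

variable {V Ω : Type*} [MeasurableSpace Ω] {Q : Matrix V V ℝ} {x : V} {P : Measure Ω}
  {Y : ℕ → Ω → V} {H : ℕ → Ω → ℝ≥0}

open Classical in
/-- The probability that the jump chain started in `x` follows the path `i` up to step `n`. -/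
noncomputable def pathProb (Q : Matrix V V ℝ) (x : V) (i : ℕ → V) (n : ℕ) : ℝ :=
  (if i 0 = x then 1 else 0) * ∏ m ∈ Finset.range n, jumpProb Q (i m) (i (m + 1))

/-- `Y` and `H` are the jump chain and the holding times of a Markov chain with rate matrix `Q`
started in `x`. -/
structure IsJumpHold (Q : Matrix V V ℝ) (x : V) (P : Measure Ω) (Y : ℕ → Ω → V)
    (H : ℕ → Ω → ℝ≥0) : Prop where
  isProbability : IsProbabilityMeasure P
  measurableSet_state : ∀ n i, MeasurableSet {ω | Y n ω = i}
  measurable_hold : ∀ n, Measurable (H n)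
  law : ∀ (n : ℕ) (i : ℕ → V) (t : ℕ → ℝ≥0),
    P {ω | ∀ m ≤ n, Y m ω = i m ∧ t m < H m ω} =
      ENNReal.ofReal (pathProb Q x i n * ∏ m ∈ Finset.range (n + 1), Real.exp (Q (i m) (i m) * t m))

/-- The states visited by the jump chain in its first `n` steps. -/
def stateHistory (Y : ℕ → Ω → V) (n : ℕ) (ω : Ω) : Fin (n + 1) → V := fun j => Y j ω

lemma measure_eq_sum_inter_fiber {ι : Type*} [Fintype ι] {f : Ω → ι}
    (hf : ∀ p, MeasurableSet (f ⁻¹' {p})) (P : Measure Ω) (E : Set Ω) :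
    P E = ∑ p, P ({ω | f ω = p} ∩ E) := by
  have := sum_measure_preimage_singleton (μ := P.restrict E) (f := f) Finset.univ
    fun p _ => hf p
  simp only [Finset.coe_univ, Set.preimage_univ, Measure.restrict_apply_univ] at this
  rw [← this]
  exact Finset.sum_congr rfl fun p _ => Measure.restrict_apply (hf p)

lemma pathProb_succ (i : ℕ → V) (n : ℕ) :
    pathProb Q x i (n + 1) = pathProb Q x i n * jumpProb Q (i n) (i (n + 1)) := by
  rw [pathProb, pathProb, Finset.prod_range_succ, mul_assoc]

lemma pathProb_congr {i j : ℕ → V} {n : ℕ} (h : ∀ m ≤ n, i m = j m) :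
    pathProb Q x i n = pathProb Q x j n := by
  unfold pathProb
  rw [h 0 (Nat.zero_le _)]
  congr 1
  refine Finset.prod_congr rfl fun m hm => ?_
  have := Finset.mem_range.1 hm
  rw [h m this.le, h (m + 1) this]

namespace IsJumpHold

lemma measurableSet_stateHistory [Finite V] (h : IsJumpHold Q x P Y H) (n : ℕ)
    (p : Fin (n + 1) → V) : MeasurableSet (stateHistory Y n ⁻¹' {p}) := by
  have : stateHistory Y n ⁻¹' {p} = ⋂ j : Fin (n + 1), {ω | Y j ω = p j} := by
    ext ω
    simp [stateHistory, funext_iff]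
  rw [this]
  exact MeasurableSet.iInter fun j => h.measurableSet_state _ _

lemma measurableSet_lt_hold (h : IsJumpHold Q x P Y H) (n : ℕ) (t : ℝ≥0) :
    MeasurableSet {ω | t < H n ω} :=
  measurableSet_lt measurable_const (h.measurable_hold n)

lemma measure_path_hold_pos (h : IsJumpHold Q x P Y H) (n : ℕ) (i : ℕ → V) :
    P {ω | ∀ m ≤ n, Y m ω = i m ∧ 0 < H m ω} = ENNReal.ofReal (pathProb Q x i n) := by
  have := h.law n i 0
  simpa using this

lemma measure_path_succ_hold_pos (h : IsJumpHold Q x P Y H) (n : ℕ) (i : ℕ → V) (k : V)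
    (t : ℝ≥0) :
    P ({ω | ∀ m ≤ n, Y m ω = i m ∧ 0 < H m ω} ∩ {ω | Y (n + 1) ω = k ∧ t < H (n + 1) ω}) =
      ENNReal.ofReal (pathProb Q x i n * (jumpProb Q (i n) k * Real.exp (Q k k * t))) := by
  classical
  have h1 := h.law (n + 1) (Function.update i (n + 1) k) (Function.update 0 (n + 1) t)
  have hne : ∀ m ≤ n, m ≠ n + 1 := fun m hm => by omega
  have hset : {ω | ∀ m ≤ n, Y m ω = i m ∧ 0 < H m ω} ∩ {ω | Y (n + 1) ω = k ∧ t < H (n + 1) ω} =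
      {ω | ∀ m ≤ n + 1, Y m ω = Function.update i (n + 1) k m ∧
        Function.update (0 : ℕ → ℝ≥0) (n + 1) t m < H m ω} := by
    ext ω
    constructor
    · rintro ⟨h2, h3⟩ m hm
      rcases Nat.lt_or_ge m (n + 1) with hlt | hge
      · rw [Function.update_of_ne hlt.ne, Function.update_of_ne hlt.ne]
        exact h2 m (by omega)
      · obtain rfl : m = n + 1 := le_antisymm hm hge
        simpa using h3
    · intro h2
      refine ⟨fun m hm => ?_, ?_⟩
      · have := h2 m (by omega)
        rwa [Function.update_of_ne (hne m hm), Function.update_of_ne (hne m hm)] at this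
      · simpa using h2 (n + 1) le_rfl
  rw [hset, h1]
  congr 1
  rw [pathProb_succ, pathProb_congr (j := i) fun m hm => Function.update_of_ne (hne m hm) _ _,
    Finset.prod_range_succ, Finset.prod_eq_one, Function.update_self, Function.update_self,
    Function.update_of_ne (hne n le_rfl)]
  · ring
  · intro m hm
    have h0 : Function.update (0 : ℕ → ℝ≥0) (n + 1) t m = 0 :=
      Function.update_of_ne (Finset.mem_range.1 hm).ne _ _
    rw [h0, NNReal.coe_zero, mul_zero, Real.exp_zero]

lemma ae_start (h : IsJumpHold Q x P Y H) : ∀ᵐ ω ∂P, Y 0 ω = x ∧ 0 < H 0 ω := by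
  have := h.isProbability
  have h1 := h.measure_path_hold_pos 0 (fun _ => x)
  have h2 : {ω | ∀ m ≤ 0, Y m ω = x ∧ 0 < H m ω} = {ω | Y 0 ω = x ∧ 0 < H 0 ω} := by
    ext ω; simp
  rw [h2] at h1
  have hm : MeasurableSet {ω | Y 0 ω = x ∧ 0 < H 0 ω} :=
    (h.measurableSet_state 0 x).inter (h.measurableSet_lt_hold 0 0)
  rw [ae_iff, ← Set.compl_ofPred, prob_compl_eq_zero_iff hm, h1]
  simp [pathProb]

variable [Fintype V]

/-- Given a path of the jump chain up to step `n`, the probabilities of all continuations with a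
positive next holding time add up to one, so that almost surely no holding time vanishes. -/
lemma ae_hold_pos (hQ : IsRateMatrix Q) (hneg : ∀ i, Q i i < 0) (h : IsJumpHold Q x P Y H) :
    ∀ᵐ ω ∂P, ∀ n, 0 < H n ω := by
  have := h.isProbability
  suffices hn : ∀ n, ∀ᵐ ω ∂P, ∀ m ≤ n, 0 < H m ω by
    filter_upwards [ae_all_iff.2 hn] with ω hω n using hω n n le_rfl
  intro n
  induction n with
  | zero => filter_upwards [h.ae_start] with ω hω m hm; rw [Nat.le_zero.1 hm]; exact hω.2
  | succ n ih =>
    have key : ∀ p : Fin (n + 1) → V, ∀ᵐ ω ∂P, stateHistory Y n ω = p →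
        (∀ m ≤ n, 0 < H m ω) → 0 < H (n + 1) ω := by
      intro p
      set i : ℕ → V := fun j => p (Fin.ofNat (n + 1) j) with hi
      set A : Set Ω := {ω | ∀ m ≤ n, Y m ω = i m ∧ 0 < H m ω} with hA
      have hmeas : MeasurableSet A := by
        have : A = ⋂ m, ⋂ (_ : m ≤ n), {ω | Y m ω = i m} ∩ {ω | 0 < H m ω} := by
          ext ω; simp [hA]
        rw [this]
        exact MeasurableSet.iInter fun m => MeasurableSet.iInter fun _ =>
          (h.measurableSet_state m _).inter (h.measurableSet_lt_hold m 0)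
      have hsum : P (A ∩ {ω | 0 < H (n + 1) ω}) = P A := by
        rw [measure_eq_sum_inter_fiber (f := Y (n + 1)) (fun l => h.measurableSet_state _ l),
          hA, h.measure_path_hold_pos n i]
        have h1 : ∀ l, P ({ω | Y (n + 1) ω = l} ∩
            ({ω | ∀ m ≤ n, Y m ω = i m ∧ 0 < H m ω} ∩ {ω | 0 < H (n + 1) ω})) =
            ENNReal.ofReal (pathProb Q x i n) * ENNReal.ofReal (jumpProb Q (i n) l) := fun l => by
          have h2 := h.measure_path_succ_hold_pos n i l 0
          rw [NNReal.coe_zero, mul_zero, Real.exp_zero, mul_one,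
            ENNReal.ofReal_mul' (jumpProb_nonneg hQ (hneg _) l)] at h2
          rw [← h2]
          congr 1
          ext ω
          simp only [Set.mem_inter_iff, Set.mem_ofPred_eq]
          tauto
        simp only [h1]
        rw [← Finset.mul_sum, ← ENNReal.ofReal_sum_of_nonneg
          fun l _ => jumpProb_nonneg hQ (hneg _) l, sum_jumpProb hQ (hneg _), ENNReal.ofReal_one,
          mul_one]
      have hdiff : P (A \ (A ∩ {ω | 0 < H (n + 1) ω})) = 0 := by
        rw [measure_sdiff Set.inter_subset_left
          (hmeas.inter (h.measurableSet_lt_hold _ _)).nullMeasurableSet (measure_ne_top _ _), hsum,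
          tsub_self]
      rw [ae_iff]
      refine measure_mono_null (fun ω hω => ?_) hdiff
      simp only [Set.mem_ofPred_eq, Classical.not_imp] at hω
      obtain ⟨h1, h2, h3⟩ := hω
      refine ⟨fun m hm => ⟨?_, h2 m hm⟩, fun h4 => h3 h4.2⟩
      rw [hi, ← h1]
      simp [stateHistory, Nat.mod_eq_of_lt (Nat.lt_succ_of_le hm)]
    filter_upwards [ih, ae_all_iff.2 key] with ω h1 h2 m hm
    rcases Nat.lt_or_ge m (n + 1) with hlt | hge
    · exact h1 m (by omega)
    · obtain rfl : m = n + 1 := le_antisymm hm hge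
      exact h2 _ rfl h1

lemma measure_history_succ (hQ : IsRateMatrix Q) (hneg : ∀ i, Q i i < 0)
    (h : IsJumpHold Q x P Y H) (n : ℕ) (p : Fin (n + 1) → V) (k : V) (t : ℝ≥0) :
    P ({ω | stateHistory Y n ω = p} ∩ {ω | Y (n + 1) ω = k ∧ t < H (n + 1) ω}) =
      P {ω | stateHistory Y n ω = p} *
        ENNReal.ofReal (jumpProb Q (p (Fin.last n)) k * Real.exp (Q k k * t)) := by
  set i : ℕ → V := fun j => p (Fin.ofNat (n + 1) j) with hi
  have hin : i n = p (Fin.last n) := by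
    simp [hi]
  have hset : {ω | ∀ m ≤ n, Y m ω = i m ∧ 0 < H m ω} =ᵐ[P] {ω | stateHistory Y n ω = p} := by
    filter_upwards [h.ae_hold_pos hQ hneg] with ω hω
    refine propext ⟨fun h1 => ?_, fun h1 m hm => ⟨?_, hω m⟩⟩
    · ext j
      have := (h1 j (Nat.lt_succ_iff.1 j.2)).1
      simpa [stateHistory, hi] using this
    · have h1 : stateHistory Y n ω = p := h1
      rw [hi, ← h1]
      simp [stateHistory, Nat.mod_eq_of_lt (Nat.lt_succ_of_le hm)]
  have hset' := measure_congr
    (hset.inter (ae_eq_refl {ω | Y (n + 1) ω = k ∧ t < H (n + 1) ω}))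
  rw [← measure_congr hset, ← hset', h.measure_path_hold_pos, h.measure_path_succ_hold_pos, hin, ENNReal.ofReal_mul' (mul_nonneg (jumpProb_nonneg hQ (hneg _) k) (Real.exp_pos _).le)]

/-- The Markov property at step `n`: given the history of the jump chain, the next state and its
holding time depend on the present state only. -/
lemma measure_mem_history_succ (hQ : IsRateMatrix Q) (hneg : ∀ i, Q i i < 0)
    (h : IsJumpHold Q x P Y H) (n : ℕ) (B : Set (Fin (n + 1) → V)) (k : V) (t : ℝ≥0) :
    P {ω | stateHistory Y n ω ∈ B ∧ Y (n + 1) ω = k ∧ t < H (n + 1) ω} =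
      ∑ l, P {ω | stateHistory Y n ω ∈ B ∧ Y n ω = l} *
        ENNReal.ofReal (jumpProb Q l k * Real.exp (Q k k * t)) := by
  classical
  have hfib := h.measurableSet_stateHistory n
  have hL : ∀ p, P ({ω | stateHistory Y n ω = p} ∩
      {ω | stateHistory Y n ω ∈ B ∧ Y (n + 1) ω = k ∧ t < H (n + 1) ω}) =
      if p ∈ B then P {ω | stateHistory Y n ω = p} *
        ENNReal.ofReal (jumpProb Q (p (Fin.last n)) k * Real.exp (Q k k * t)) else 0 := by
    intro p
    split_ifs with hp
    · rw [← h.measure_history_succ hQ hneg]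
      congr 1
      ext ω
      simp only [Set.mem_inter_iff, Set.mem_ofPred_eq]
      refine and_congr_right fun h1 => ?_
      rw [h1]
      tauto
    · rw [← measure_empty (μ := P)]
      congr 1
      ext ω
      simp only [Set.mem_inter_iff, Set.mem_ofPred_eq, Set.mem_empty_iff_false, iff_false]
      rintro ⟨rfl, h2, -⟩
      exact hp h2
  have hR : ∀ l p, P ({ω | stateHistory Y n ω = p} ∩ {ω | stateHistory Y n ω ∈ B ∧ Y n ω = l}) =
      if p (Fin.last n) = l then (if p ∈ B then P {ω | stateHistory Y n ω = p} else 0) else 0 := by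
    intro l p
    have hlast : ∀ ω, stateHistory Y n ω = p → Y n ω = p (Fin.last n) := by
      rintro ω rfl; rfl
    split_ifs with h1 h2
    · congr 1
      ext ω
      simp only [Set.mem_inter_iff, Set.mem_ofPred_eq, and_iff_left_iff_imp]
      intro h3
      exact ⟨h3 ▸ h2, (hlast ω h3).trans h1⟩
    · rw [← measure_empty (μ := P)]
      congr 1
      ext ω
      simp only [Set.mem_inter_iff, Set.mem_ofPred_eq, Set.mem_empty_iff_false, iff_false]
      rintro ⟨rfl, h3, -⟩
      exact h2 h3
    · rw [← measure_empty (μ := P)]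
      congr 1
      ext ω
      simp only [Set.mem_inter_iff, Set.mem_ofPred_eq, Set.mem_empty_iff_false, iff_false]
      rintro ⟨h2, -, h3⟩
      exact h1 ((hlast ω h2).symm.trans h3)
  rw [measure_eq_sum_inter_fiber hfib]
  simp only [hL]
  have hR' : ∀ l, P {ω | stateHistory Y n ω ∈ B ∧ Y n ω = l} = ∑ p : Fin (n + 1) → V,
      if p (Fin.last n) = l then (if p ∈ B then P {ω | stateHistory Y n ω = p} else 0) else 0 := by
    intro l
    rw [measure_eq_sum_inter_fiber hfib]
    exact Finset.sum_congr rfl fun p _ => hR l p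
  simp only [hR', Finset.sum_mul]
  rw [Finset.sum_comm]
  refine Finset.sum_congr rfl fun p _ => ?_
  simp only [ite_mul, zero_mul]
  rw [Finset.sum_ite_eq]
  simp

end IsJumpHold

end JumpHold

end GluedChain

namespace GluedChain

/-! ### Visits on an excursion from the distinguished states -/

section Visit

open MeasureTheory

variable {S Ω : Type*} {e : Fin 2} {Y : ℕ → Ω → S ⊕ Fin 2} {H : ℕ → Ω → ℝ≥0}

/-- The event that the `n`-th state of the jump chain is `k` and that no distinguished state is
visited in between, the initial state being disregarded. -/
def visit (Y : ℕ → Ω → S ⊕ Fin 2) (n : ℕ) (k : S) : Set Ω :=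
  {ω | Y n ω = .inl k ∧ ∀ j, 0 < j → j < n → ∃ l, Y j ω = .inl l}

/-- The expected number of visits to `k` on an excursion from the initial state. -/
noncomputable def greenMass [MeasurableSpace Ω] (P : Measure Ω) (Y : ℕ → Ω → S ⊕ Fin 2) (k : S) : ℝ≥0∞ :=
  ∑' n, P (visit Y (n + 1) k)

open Classical in
/-- The time spent in `k` on the excursion from the initial state, in terms of the jump chain and
the holding times. -/
noncomputable def excursionTime (Y : ℕ → Ω → S ⊕ Fin 2) (H : ℕ → Ω → ℝ≥0) (k : S) (ω : Ω) :
    ℝ≥0∞ :=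
  ∑' n, (visit Y (n + 1) k).indicator (fun ω => (H (n + 1) ω : ℝ≥0∞)) ω

/-- The event that the first distinguished state visited by the jump chain at a positive step
is `f`. -/
def exitAt (Y : ℕ → Ω → S ⊕ Fin 2) (f : Fin 2) : Set Ω :=
  {ω | ∃ n, Y (n + 1) ω = .inr f ∧ ∀ j, 0 < j → j < n + 1 → ∃ l, Y j ω = .inl l}

lemma exists_exit {y : ℕ → S ⊕ Fin 2} (h : ∃ n, ∃ f, y (n + 1) = .inr f) :
    ∃ n f, y (n + 1) = .inr f ∧ ∀ j, 0 < j → j < n + 1 → ∃ l, y j = .inl l := by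
  classical
  obtain ⟨f, hf⟩ := Nat.find_spec h
  refine ⟨Nat.find h, f, hf, fun j hj hjn => ?_⟩
  obtain ⟨m, rfl⟩ := Nat.exists_eq_succ_of_ne_zero hj.ne'
  rcases hy : y (m + 1) with l | f'
  · exact ⟨l, rfl⟩
  · exact absurd ⟨f', hy⟩ (Nat.find_min h (by omega))

lemma eq_of_mem_exitAt {ω : Ω} {f f' : Fin 2} (h : ω ∈ exitAt Y f) (h' : ω ∈ exitAt Y f') :
    f = f' := by
  obtain ⟨n, hn, hn'⟩ := h
  obtain ⟨m, hm, hm'⟩ := h'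
  rcases lt_trichotomy n m with h | rfl | h
  · obtain ⟨l, hl⟩ := hm' (n + 1) (Nat.succ_pos _) (by omega)
    simp [hl] at hn
  · exact Sum.inr_injective (hn.symm.trans hm)
  · obtain ⟨l, hl⟩ := hn' (m + 1) (Nat.succ_pos _) (by omega)
    simp [hl] at hm

lemma excursionTime_eq_sum {ω : Ω} {n : ℕ} {f : Fin 2} (h0 : Y 0 ω = .inr e)
    (hn : Y (n + 1) ω = .inr f) (hlt : ∀ j, 0 < j → j < n + 1 → ∃ l, Y j ω = .inl l) (k : S)
    [DecidableEq (S ⊕ Fin 2)] :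
    excursionTime Y H k ω =
      ∑ j ∈ Finset.range (n + 1), if Y j ω = .inl k then (H j ω : ℝ≥0∞) else 0 := by
  rw [Finset.sum_range_succ', h0, if_neg (by simp), add_zero, excursionTime,
    tsum_eq_sum (s := Finset.range n)]
  · refine Finset.sum_congr rfl fun m hm => ?_
    have hm := Finset.mem_range.1 hm
    by_cases hk : Y (m + 1) ω = .inl k
    · rw [if_pos hk, Set.indicator_of_mem]
      exact ⟨hk, fun j hj hjm => hlt j hj (by omega)⟩
    · rw [if_neg hk, Set.indicator_of_notMem]
      exact fun h => hk h.1
  · intro m hm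
    refine Set.indicator_of_notMem (fun h => ?_) _
    have hnm : n ≤ m := not_lt.1 (fun hc => hm (Finset.mem_range.2 hc))
    rcases hnm.eq_or_lt with rfl | hlt'
    · have := h.1
      simp [hn] at this
    · obtain ⟨l, hl⟩ := h.2 (n + 1) (Nat.succ_pos _) (by omega)
      simp [hn] at hl

variable [MeasurableSpace Ω] {Q : Matrix (S ⊕ Fin 2) (S ⊕ Fin 2) ℝ} {P : Measure Ω}

namespace IsJumpHold

lemma measurableSet_inl [Finite S] (h : IsJumpHold Q (.inr e) P Y H) (n : ℕ) :
    MeasurableSet {ω | ∃ l, Y n ω = .inl l} := by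
  have : {ω | ∃ l, Y n ω = .inl l} = ⋃ l : S, {ω | Y n ω = .inl l} := by ext; simp
  rw [this]
  exact MeasurableSet.iUnion fun l => h.measurableSet_state _ _

lemma measurableSet_forall_inl [Finite S] (h : IsJumpHold Q (.inr e) P Y H) (n : ℕ) :
    MeasurableSet {ω | ∀ j, 0 < j → j < n → ∃ l, Y j ω = .inl l} := by
  have : {ω | ∀ j, 0 < j → j < n → ∃ l, Y j ω = .inl l} =
      ⋂ j, ⋂ (_ : 0 < j), ⋂ (_ : j < n), {ω | ∃ l, Y j ω = .inl l} := by ext; simp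
  rw [this]
  exact MeasurableSet.iInter fun j => MeasurableSet.iInter fun _ => MeasurableSet.iInter fun _ =>
    h.measurableSet_inl j

lemma measurableSet_visit [Finite S] (h : IsJumpHold Q (.inr e) P Y H) (n : ℕ) (k : S) :
    MeasurableSet (visit Y n k) :=
  (h.measurableSet_state n _).inter (h.measurableSet_forall_inl n)

lemma measurableSet_exitAt [Finite S] (h : IsJumpHold Q (.inr e) P Y H) (f : Fin 2) :
    MeasurableSet (exitAt Y f) := by
  have : exitAt Y f = ⋃ n, ({ω | Y (n + 1) ω = .inr f} ∩
      {ω | ∀ j, 0 < j → j < n + 1 → ∃ l, Y j ω = .inl l}) := by ext; simp [exitAt]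
  rw [this]
  exact MeasurableSet.iUnion fun n =>
    (h.measurableSet_state _ _).inter (h.measurableSet_forall_inl _)

lemma measurable_excursionTime [Finite S] (h : IsJumpHold Q (.inr e) P Y H) (k : S) :
    Measurable (excursionTime Y H k) :=
  Measurable.tsum fun n =>
    (h.measurable_hold (n + 1)).coe_nnreal_ennreal.indicator (h.measurableSet_visit _ _)

variable [Fintype S]

lemma measure_visit_inter_lt_hold (hQ : IsRateMatrix Q) (hneg : ∀ i, Q i i < 0)
    (h : IsJumpHold Q (.inr e) P Y H) (n : ℕ) (k : S) (t : ℝ≥0) :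
    P (visit Y (n + 1) k ∩ {ω | t < H (n + 1) ω}) =
      (∑ l, P {ω | (∀ j, 0 < j → j < n + 1 → ∃ l, Y j ω = .inl l) ∧ Y n ω = l} *
        ENNReal.ofReal (jumpProb Q l (.inl k))) *
          ENNReal.ofReal (Real.exp (Q (.inl k) (.inl k) * t)) := by
  have hmem : ∀ ω, stateHistory Y n ω ∈
      {p : Fin (n + 1) → S ⊕ Fin 2 | ∀ j : Fin (n + 1), (0 : ℕ) < j → ∃ l, p j = .inl l} ↔
      ∀ j, 0 < j → j < n + 1 → ∃ l, Y j ω = .inl l := fun ω =>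
    ⟨fun hp j hj hjn => hp ⟨j, hjn⟩ hj, fun hp j hj => hp j hj j.2⟩
  have h1 := h.measure_mem_history_succ hQ hneg n
    {p : Fin (n + 1) → S ⊕ Fin 2 | ∀ j : Fin (n + 1), (0 : ℕ) < j → ∃ l, p j = .inl l} (.inl k) t
  simp only [hmem] at h1
  rw [Finset.sum_mul]
  have h2 : ∀ l, ENNReal.ofReal (jumpProb Q l (.inl k) * Real.exp (Q (.inl k) (.inl k) * t)) =
      ENNReal.ofReal (jumpProb Q l (.inl k)) *
        ENNReal.ofReal (Real.exp (Q (.inl k) (.inl k) * t)) := fun l =>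
    ENNReal.ofReal_mul (jumpProb_nonneg hQ (hneg l) _)
  simp only [h2, ← mul_assoc] at h1
  rw [← h1]
  congr 1
  ext ω
  simp only [visit, Set.mem_inter_iff, Set.mem_ofPred_eq]
  tauto

lemma measure_visit_succ (hQ : IsRateMatrix Q) (hneg : ∀ i, Q i i < 0)
    (h : IsJumpHold Q (.inr e) P Y H) (n : ℕ) (k : S) :
    P (visit Y (n + 1) k) =
      ∑ l, P {ω | (∀ j, 0 < j → j < n + 1 → ∃ l, Y j ω = .inl l) ∧ Y n ω = l} *
        ENNReal.ofReal (jumpProb Q l (.inl k)) := by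
  have h1 := h.measure_visit_inter_lt_hold hQ hneg n k 0
  rw [NNReal.coe_zero, mul_zero, Real.exp_zero, ENNReal.ofReal_one, mul_one] at h1
  rw [← h1]
  refine measure_congr ?_
  filter_upwards [h.ae_hold_pos hQ hneg] with ω hω
  exact propext ⟨fun h2 => ⟨h2, hω _⟩, fun h2 => h2.1⟩

lemma measure_visit_one (hQ : IsRateMatrix Q) (hneg : ∀ i, Q i i < 0)
    (h : IsJumpHold Q (.inr e) P Y H) (k : S) :
    P (visit Y 1 k) = ENNReal.ofReal (jumpProb Q (.inr e) (.inl k)) := by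
  classical
  have := h.isProbability
  have h1 : ∀ l, P {ω | (∀ j, 0 < j → j < 0 + 1 → ∃ l, Y j ω = .inl l) ∧ Y 0 ω = l} =
      if l = .inr e then 1 else 0 := by
    intro l
    split_ifs with hl
    · rw [hl, ← measure_univ (μ := P)]
      refine measure_congr ?_
      filter_upwards [h.ae_start] with ω hω
      exact propext ⟨fun _ => trivial, fun _ => ⟨fun j hj hj' => by omega, hω.1⟩⟩
    · rw [← measure_empty (μ := P)]
      refine measure_congr ?_
      filter_upwards [h.ae_start] with ω hω
      exact propext ⟨fun h2 => hl (h2.2.symm.trans hω.1), fun h2 => h2.elim⟩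
  rw [← zero_add 1, h.measure_visit_succ hQ hneg 0 k]
  simp only [h1, ite_mul, one_mul, zero_mul, Finset.sum_ite_eq', Finset.mem_univ, if_true]

lemma measure_visit_add_two (hQ : IsRateMatrix Q) (hneg : ∀ i, Q i i < 0)
    (h : IsJumpHold Q (.inr e) P Y H) (n : ℕ) (k : S) :
    P (visit Y (n + 1 + 1) k) =
      ∑ l, P (visit Y (n + 1) l) * ENNReal.ofReal (jumpProb Q (.inl l) (.inl k)) := by
  rw [h.measure_visit_succ hQ hneg (n + 1) k, Fintype.sum_sum_type]
  have h1 : ∀ l : S, {ω | (∀ j, 0 < j → j < n + 1 + 1 → ∃ l, Y j ω = .inl l) ∧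
      Y (n + 1) ω = .inl l} = visit Y (n + 1) l := by
    intro l
    ext ω
    constructor
    · rintro ⟨h1, h2⟩
      exact ⟨h2, fun j hj hj' => h1 j hj (by omega)⟩
    · rintro ⟨h1, h2⟩
      refine ⟨fun j hj hj' => ?_, h1⟩
      rcases Nat.lt_or_ge j (n + 1) with hlt | hge
      · exact h2 j hj hlt
      · obtain rfl : j = n + 1 := by omega
        exact ⟨l, h1⟩
  have h2 : ∀ f : Fin 2, {ω | (∀ j, 0 < j → j < n + 1 + 1 → ∃ l, Y j ω = .inl l) ∧
      Y (n + 1) ω = .inr f} = ∅ := by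
    intro f
    refine Set.eq_empty_of_forall_notMem ?_
    rintro ω ⟨h1, h2⟩
    obtain ⟨l, hl⟩ := h1 (n + 1) (by omega) (by omega)
    simp [hl] at h2
  simp only [h1, h2, measure_empty, zero_mul, Finset.sum_const_zero, add_zero]

/-- First-step equation for the expected numbers of visits. -/
lemma greenMass_eq (hQ : IsRateMatrix Q) (hneg : ∀ i, Q i i < 0)
    (h : IsJumpHold Q (.inr e) P Y H) (k : S) :
    greenMass P Y k = ENNReal.ofReal (jumpProb Q (.inr e) (.inl k)) +
      ∑ l, greenMass P Y l * ENNReal.ofReal (jumpProb Q (.inl l) (.inl k)) := by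
  rw [greenMass, tsum_eq_zero_add' ENNReal.summable, zero_add, h.measure_visit_one hQ hneg]
  simp only [h.measure_visit_add_two hQ hneg, greenMass]
  rw [Summable.tsum_finsetSum fun _ _ => ENNReal.summable]
  simp only [ENNReal.tsum_mul_right]

/-- A stationary distribution dominates the expected numbers of visits, since it solves the
first-step equation with a larger right-hand side. -/
lemma greenMass_le (hQ : IsRateMatrix Q) (hirr : IsIrreducible Q)
    (h : IsJumpHold Q (.inr e) P Y H) {p : S ⊕ Fin 2 → ℝ} (hp : IsStationary Q p) (k : S) :
    greenMass P Y k ≤ ENNReal.ofReal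
      (p (.inl k) * -Q (.inl k) (.inl k) / (p (.inr e) * -Q (.inr e) (.inr e))) := by
  have : Nontrivial (S ⊕ Fin 2) := ⟨.inr 0, .inr 1, by simp⟩
  have hneg := hQ.diag_neg hirr
  have hpos := hp.pos hQ hirr
  have hc : 0 < p (.inr e) * -Q (.inr e) (.inr e) := mul_pos (hpos _) (neg_pos.2 (hneg _))
  set C : S → ℝ := fun k =>
    p (.inl k) * -Q (.inl k) (.inl k) / (p (.inr e) * -Q (.inr e) (.inr e)) with hC
  have hC0 : ∀ k, 0 ≤ C k := fun k =>
    div_nonneg (mul_pos (hpos _) (neg_pos.2 (hneg _))).le hc.le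
  have hj : ∀ i j, 0 ≤ jumpProb Q i j := fun i j => jumpProb_nonneg hQ (hneg i) j
  have hsup : ∀ k, jumpProb Q (.inr e) (.inl k) + ∑ l, C l * jumpProb Q (.inl l) (.inl k) ≤
      C k := by
    intro k
    have h1 := hp.sum_mul_jumpProb hneg (.inl k)
    rw [Fintype.sum_sum_type] at h1
    have h2 : p (.inr e) * -Q (.inr e) (.inr e) * jumpProb Q (.inr e) (.inl k) ≤
        ∑ f, p (.inr f) * -Q (.inr f) (.inr f) * jumpProb Q (.inr f) (.inl k) :=
      Finset.single_le_sum
        (f := fun f => p (.inr f) * -Q (.inr f) (.inr f) * jumpProb Q (.inr f) (.inl k))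
        (fun f _ => mul_nonneg (mul_pos (hpos _) (neg_pos.2 (hneg _))).le (hj _ _))
        (Finset.mem_univ e)
    simp only [hC, div_mul_eq_mul_div]
    rw [← Finset.sum_div, ← sub_nonneg, ← sub_sub, sub_right_comm, ← sub_div, sub_nonneg,
      le_div_iff₀ hc]
    linarith
  have hind : ∀ N k, ∑ n ∈ Finset.range N, P (visit Y (n + 1) k) ≤ ENNReal.ofReal (C k) := by
    intro N
    induction N with
    | zero => simp
    | succ N ih =>
      intro k
      rw [Finset.sum_range_succ', h.measure_visit_one hQ hneg]
      simp only [h.measure_visit_add_two hQ hneg]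
      rw [Finset.sum_comm]
      simp only [← Finset.sum_mul]
      calc _ ≤ ∑ l, ENNReal.ofReal (C l) * ENNReal.ofReal (jumpProb Q (.inl l) (.inl k)) +
            ENNReal.ofReal (jumpProb Q (.inr e) (.inl k)) := by
            gcongr with l
            exact ih l
        _ = ENNReal.ofReal (jumpProb Q (.inr e) (.inl k) +
            ∑ l, C l * jumpProb Q (.inl l) (.inl k)) := by
            rw [ENNReal.ofReal_add (hj _ _)
              (Finset.sum_nonneg fun l _ => mul_nonneg (hC0 l) (hj _ _)),
              ENNReal.ofReal_sum_of_nonneg fun l _ => mul_nonneg (hC0 l) (hj _ _), add_comm]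
            simp only [ENNReal.ofReal_mul (hC0 _)]
        _ ≤ _ := ENNReal.ofReal_le_ofReal (hsup k)
  rw [greenMass, ENNReal.tsum_eq_iSup_nat]
  exact iSup_le fun N => hind N k

/-- As the expected number of steps before the return is finite, the distinguished states are
almost surely visited again. -/
lemma ae_exists_exit {p : S ⊕ Fin 2 → ℝ} (hp : IsStationary Q p) (hQ : IsRateMatrix Q)
    (hirr : IsIrreducible Q) (h : IsJumpHold Q (.inr e) P Y H) :
    ∀ᵐ ω ∂P, ∃ n, ∃ f, Y (n + 1) ω = .inr f := by
  rw [ae_iff]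
  have htend : Filter.Tendsto (fun n => ∑ k, P (visit Y (n + 1) k)) Filter.atTop (nhds 0) := by
    rw [← Finset.sum_const_zero (s := (Finset.univ : Finset S)) (M := ℝ≥0∞)]
    refine tendsto_finsetSum _ fun k _ => ENNReal.tendsto_atTop_zero_of_tsum_ne_top ?_
    exact ((h.greenMass_le hQ hirr hp k).trans_lt ENNReal.ofReal_lt_top).ne
  refine le_antisymm (ge_of_tendsto' htend fun n => ?_) zero_le
  refine (measure_mono fun ω hω => ?_).trans (measure_iUnion_fintype_le P _)
  have hω : ¬ ∃ n, ∃ f, Y (n + 1) ω = .inr f := hω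
  have hinl : ∀ j, 0 < j → ∃ l, Y j ω = .inl l := by
    intro j hj
    obtain ⟨m, rfl⟩ := Nat.exists_eq_succ_of_ne_zero hj.ne'
    rcases hy : Y (m + 1) ω with l | f
    · exact ⟨l, rfl⟩
    · exact absurd ⟨m, f, hy⟩ hω
  obtain ⟨k, hk⟩ := hinl (n + 1) (Nat.succ_pos _)
  exact Set.mem_iUnion.2 ⟨k, hk, fun j hj _ => hinl j hj⟩

/-- The holding time of a visit to `k` is exponential with parameter `-Q k k`. -/
lemma setLIntegral_visit_hold (hQ : IsRateMatrix Q) (hneg : ∀ i, Q i i < 0)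
    (h : IsJumpHold Q (.inr e) P Y H) (n : ℕ) (k : S) :
    ∫⁻ ω in visit Y (n + 1) k, (H (n + 1) ω : ℝ≥0∞) ∂P =
      P (visit Y (n + 1) k) * ENNReal.ofReal (-Q (.inl k) (.inl k))⁻¹ := by
  have h1 := lintegral_eq_lintegral_meas_lt (P.restrict (visit Y (n + 1) k))
    (f := fun ω => (H (n + 1) ω : ℝ)) (Filter.Eventually.of_forall fun ω => NNReal.coe_nonneg _)
    (h.measurable_hold _).coe_nnreal_real.aemeasurable
  simp only [ENNReal.ofReal_coe_nnreal] at h1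
  rw [h1]
  have h2 : ∀ t ∈ Set.Ioi (0 : ℝ),
      (P.restrict (visit Y (n + 1) k)) {ω | t < (H (n + 1) ω : ℝ)} =
      P (visit Y (n + 1) k) * ENNReal.ofReal (Real.exp (Q (.inl k) (.inl k) * t)) := by
    intro t ht
    have ht : 0 < t := ht
    have h3 : {ω | t < (H (n + 1) ω : ℝ)} = {ω | t.toNNReal < H (n + 1) ω} := by
      ext ω
      exact (Real.toNNReal_lt_iff_lt_coe ht.le).symm
    have h4 := h.measure_visit_inter_lt_hold hQ hneg n k t.toNNReal
    rw [← h.measure_visit_succ hQ hneg, Real.coe_toNNReal _ ht.le] at h4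
    rw [h3, Measure.restrict_apply (h.measurableSet_lt_hold _ _), Set.inter_comm, h4]
  rw [setLIntegral_congr_fun measurableSet_Ioi h2, lintegral_const_mul _ (by fun_prop),
    ← ofReal_integral_eq_lintegral_ofReal (integrableOn_exp_mul_Ioi (hneg _) 0)
      (Filter.Eventually.of_forall fun t => (Real.exp_pos _).le),
    integral_exp_mul_Ioi (hneg _) 0]
  congr 2
  rw [mul_zero, Real.exp_zero, inv_neg, neg_div, one_div]

lemma lintegral_excursionTime (hQ : IsRateMatrix Q) (hneg : ∀ i, Q i i < 0)
    (h : IsJumpHold Q (.inr e) P Y H) (k : S) :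
    ∫⁻ ω, excursionTime Y H k ω ∂P =
      greenMass P Y k * ENNReal.ofReal (-Q (.inl k) (.inl k))⁻¹ := by
  unfold excursionTime greenMass
  rw [lintegral_tsum fun n => ((h.measurable_hold (n + 1)).coe_nnreal_ennreal.indicator
    (h.measurableSet_visit _ _)).aemeasurable, ← ENNReal.tsum_mul_right]
  refine tsum_congr fun n => ?_
  rw [lintegral_indicator (h.measurableSet_visit _ _), h.setLIntegral_visit_hold hQ hneg]

/-- The expected numbers of visits, weighted by the mean holding times and the total rate of leaving
the initial state, solve the balance equations. -/
lemma isExcursionSolution {p : S ⊕ Fin 2 → ℝ} (hp : IsStationary Q p) (hQ : IsRateMatrix Q)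
    (hirr : IsIrreducible Q) (h : IsJumpHold Q (.inr e) P Y H) :
    IsExcursionSolution Q e fun k =>
      -Q (.inr e) (.inr e) * ((greenMass P Y k).toReal * (-Q (.inl k) (.inl k))⁻¹) := by
  classical
  have : Nontrivial (S ⊕ Fin 2) := ⟨.inr 0, .inr 1, by simp⟩
  have hneg := hQ.diag_neg hirr
  have hj : ∀ i j, 0 ≤ jumpProb Q i j := fun i j => jumpProb_nonneg hQ (hneg i) j
  have hfin : ∀ k, greenMass P Y k ≠ ⊤ := fun k =>
    ((h.greenMass_le hQ hirr hp k).trans_lt ENNReal.ofReal_lt_top).ne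
  refine ⟨fun k => mul_nonneg (neg_pos.2 (hneg _)).le
    (mul_nonneg ENNReal.toReal_nonneg (inv_nonneg.2 (neg_pos.2 (hneg _)).le)), fun k => ?_⟩
  have h1 := congrArg ENNReal.toReal (h.greenMass_eq hQ hneg k)
  rw [ENNReal.toReal_add ENNReal.ofReal_ne_top (ENNReal.sum_ne_top.2 fun l _ =>
      ENNReal.mul_ne_top (hfin l) ENNReal.ofReal_ne_top), ENNReal.toReal_sum fun l _ =>
      ENNReal.mul_ne_top (hfin l) ENNReal.ofReal_ne_top] at h1
  simp only [ENNReal.toReal_mul, ENNReal.toReal_ofReal (hj _ _)] at h1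
  have hne : ∀ i, Q i i ≠ 0 := fun i => (hneg i).ne
  have h2 : ∀ l, -Q (.inr e) (.inr e) *
      ((greenMass P Y l).toReal * (-Q (.inl l) (.inl l))⁻¹) * Q (.inl l) (.inl k) =
      -Q (.inr e) (.inr e) * ((greenMass P Y l).toReal * jumpProb Q (.inl l) (.inl k) -
        if l = k then (greenMass P Y k).toReal else 0) := by
    intro l
    have := hne (.inl l)
    by_cases hl : l = k
    · subst hl
      simp only [jumpProb, if_true, mul_zero]
      field_simp
      ring
    · rw [jumpProb, if_neg (by simpa using hl), if_neg hl]
      field_simp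
      ring
  have h3 : Q (.inr e) (.inl k) = -Q (.inr e) (.inr e) * jumpProb Q (.inr e) (.inl k) := by
    have := hne (.inr e)
    rw [jumpProb, if_neg (by simp)]
    field_simp
  simp only [h2]
  rw [← Finset.mul_sum, Finset.sum_sub_distrib, Finset.sum_ite_eq', if_pos (Finset.mem_univ _), h3]
  linear_combination Q (.inr e) (.inr e) * h1

end IsJumpHold

end Visit

end GluedChain

namespace GluedChain

/-! ### Excursion weights of a Markov jump process -/

section ExcursionWeight

open MeasureTheory

variable {S Ω : Type*} {e : Fin 2} {X : ℝ≥0 → Ω → S ⊕ Fin 2}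

/-- On a path that enters the distinguished state `f` when it first visits one of the two after its
initial state, only the event `exitEvent X f` occurs, and the occupation time is a sum of holding
times. -/
lemma indicator_exitEvent_eq {Y : ℕ → Ω → S ⊕ Fin 2} {H : ℕ → Ω → ℝ≥0} {ω : Ω}
    (hstep : IsStepPath (fun t => X t ω) (fun n => Y n ω) (fun n => H n ω))
    (h0 : Y 0 ω = .inr e) (h1 : Y 1 ω ≠ .inr e) {f₀ : Fin 2} (hf₀ : ω ∈ exitAt Y f₀)
    (f : Fin 2) (k : S) :
    (exitEvent X f).indicator (fun ω => occupation (fun t => X t ω) (.inr f) (.inl k)) ω =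
      (exitAt Y f).indicator (excursionTime Y H k) ω := by
  classical
  obtain ⟨n, hn, hlt⟩ := id hf₀
  have h01 : Y 1 ω ≠ Y 0 ω := by rwa [h0]
  have hne : ∀ j, 0 < j → j < n + 1 → Y j ω ≠ .inr f₀ := fun j hj hj' hc => by
    obtain ⟨l, hl⟩ := hlt j hj hj'
    simp [hl] at hc
  have hrev : f₀ ≠ f₀.rev := by fin_cases f₀ <;> decide
  have hne' : ∀ j, 0 < j → j < n + 1 + 1 → Y j ω ≠ .inr f₀.rev := fun j hj hj' hc => by
    rcases Nat.lt_or_ge j (n + 1) with h | h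
    · obtain ⟨l, hl⟩ := hlt j hj h
      simp [hl] at hc
    · obtain rfl : j = n + 1 := by omega
      exact hrev (Sum.inr_injective (hn.symm.trans hc))
  have hhit : hitTime (fun t => X t ω) (.inr f₀) < hitTime (fun t => X t ω) (.inr f₀.rev) := by
    rw [hstep.hitTime_eq h01 (Nat.succ_pos n) hn hne]
    exact (ENNReal.coe_lt_coe.2 (hstep.sum_lt (Nat.lt_succ_self _))).trans_le
      (hstep.le_hitTime hne')
  by_cases hf : f = f₀
  · subst hf
    rw [Set.indicator_of_mem (show ω ∈ exitEvent X f from hhit), Set.indicator_of_mem hf₀,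
      excursionTime_eq_sum h0 hn hlt, hstep.occupation_eq h01 (Nat.succ_pos n) hn hne]
    exact Finset.sum_congr rfl fun j _ => by congr
  · rw [Set.indicator_of_notMem, Set.indicator_of_notMem fun h => hf (eq_of_mem_exitAt h hf₀)]
    have hfr : f = f₀.rev := by
      revert hf; fin_cases f <;> fin_cases f₀ <;> decide
    intro h
    have h' : hitTime (fun t => X t ω) (.inr f) < hitTime (fun t => X t ω) (.inr f.rev) := h
    rw [hfr, Fin.rev_rev] at h'
    exact lt_asymm h' hhit

variable [MeasurableSpace Ω] {Q : Matrix (S ⊕ Fin 2) (S ⊕ Fin 2) ℝ} {P : Fin 2 → Measure Ω}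

lemma excursionRate_mul_condOccupation (hfin : IsProbabilityMeasure (P e)) (f : Fin 2) (k : S) :
    excursionRate Q P X e f * condOccupation P X e f k =
      ENNReal.ofReal (-Q (.inr e) (.inr e)) * ∫⁻ ω, (exitEvent X f).indicator
        (fun ω => occupation (fun t => X t ω) (.inr f) (.inl k)) ω ∂(P e) := by
  rw [excursionRate, condOccupation, mul_assoc]
  congr 1
  split_ifs with h
  · rw [ENNReal.mul_div_cancel h (measure_ne_top _ _)]
  · have h0 : P e (exitEvent X f) = 0 := not_not.1 h
    rw [mul_zero, lintegral_congr_ae (indicator_meas_zero h0)]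
    simp

/-- The excursion weights are the expected occupation times of the excursion, multiplied by the
total rate of leaving `e`; they are finite and solve the balance equations. -/
lemma IsMarkovJumpProcess.excursionWeight_ne_top_and_isExcursionSolution [Fintype S]
    (hQ : IsRateMatrix Q) (hirr : IsIrreducible Q) {p : S ⊕ Fin 2 → ℝ} (hp : IsStationary Q p)
    (hX : IsMarkovJumpProcess Q (.inr e) (P e) X) :
    (∀ k, excursionWeight Q P X e k ≠ ⊤) ∧
      IsExcursionSolution Q e fun k => (excursionWeight Q P X e k).toReal := by
  have : Nontrivial (S ⊕ Fin 2) := ⟨.inr 0, .inr 1, by simp⟩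
  have hneg := hQ.diag_neg hirr
  have hprob := hX.isProbability
  obtain ⟨Y, H, hY, hH, hstep, hlaw⟩ := hX.exists_jump_hold
  have h : IsJumpHold Q (.inr e) (P e) Y H := ⟨hprob, hY, hH, hlaw⟩
  have hne : ∀ᵐ ω ∂(P e), Y 1 ω ≠ .inr e := by
    have h1 := h.measure_path_succ_hold_pos 0 (fun _ => .inr e) (.inr e) 0
    rw [jumpProb, if_pos rfl, zero_mul, mul_zero, ENNReal.ofReal_zero] at h1
    filter_upwards [h.ae_start, h.ae_hold_pos hQ hneg, measure_eq_zero_iff_ae_notMem.1 h1]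
      with ω h2 h3 h4 h5
    refine h4 ⟨fun m hm => ⟨?_, h3 m⟩, h5, h3 1⟩
    rw [Nat.le_zero.1 hm]
    exact h2.1
  have hae : ∀ k, ∀ᵐ ω ∂(P e), (∃ f, ω ∈ exitAt Y f) ∧ ∀ f, (exitEvent X f).indicator
      (fun ω => occupation (fun t => X t ω) (.inr f) (.inl k)) ω =
        (exitAt Y f).indicator (excursionTime Y H k) ω := by
    intro k
    filter_upwards [hstep, h.ae_start, h.ae_hold_pos hQ hneg, hne, h.ae_exists_exit hp hQ hirr]
      with ω h1 h2 h3 h4 h5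
    obtain ⟨n, f, hn⟩ := exists_exit (y := fun n => Y n ω) h5
    exact ⟨⟨f, n, hn⟩, fun f' => indicator_exitEvent_eq ⟨h3, h1⟩ h2.1 h4 ⟨n, hn⟩ f' k⟩
  have hw : ∀ k, excursionWeight Q P X e k = ENNReal.ofReal (-Q (.inr e) (.inr e)) *
      (greenMass (P e) Y k * ENNReal.ofReal (-Q (.inl k) (.inl k))⁻¹) := by
    intro k
    rw [excursionWeight]
    simp only [excursionRate_mul_condOccupation hprob]
    rw [← Finset.mul_sum, ← h.lintegral_excursionTime hQ hneg k, Fin.sum_univ_two,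
      lintegral_congr_ae ((hae k).mono fun ω hω => hω.2 0),
      lintegral_congr_ae ((hae k).mono fun ω hω => hω.2 1),
      ← lintegral_add_left ((h.measurable_excursionTime k).indicator (h.measurableSet_exitAt 0))]
    congr 1
    refine lintegral_congr_ae ?_
    filter_upwards [hae k] with ω hω
    obtain ⟨f, hf⟩ := hω.1
    obtain rfl | rfl : f = 0 ∨ f = 1 := by omega
    · rw [Set.indicator_of_mem hf, Set.indicator_of_notMem
        fun h' => absurd (eq_of_mem_exitAt hf h') (by decide), add_zero]
    · rw [Set.indicator_of_notMem fun h' => absurd (eq_of_mem_exitAt hf h') (by decide),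
        Set.indicator_of_mem hf, zero_add]
  have hfin : ∀ k, greenMass (P e) Y k ≠ ⊤ := fun k =>
    ((h.greenMass_le hQ hirr hp k).trans_lt ENNReal.ofReal_lt_top).ne
  refine ⟨fun k => ?_, ?_⟩
  · rw [hw]
    exact ENNReal.mul_ne_top ENNReal.ofReal_ne_top
      (ENNReal.mul_ne_top (hfin k) ENNReal.ofReal_ne_top)
  · have h1 := h.isExcursionSolution hp hQ hirr
    convert! h1 using 2 with k
    rw [hw, ENNReal.toReal_mul, ENNReal.toReal_mul, ENNReal.toReal_ofReal (neg_pos.2 (hneg _)).le,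
      ENNReal.toReal_ofReal (inv_nonneg.2 (neg_pos.2 (hneg _)).le)]

end ExcursionWeight

/-! ### The glued chain -/

section Glued

variable {S SA SB : Type*} [Fintype S] [Fintype SA] [Fintype SB]
  {QA : Matrix (SA ⊕ Fin 2) (SA ⊕ Fin 2) ℝ} {QB : Matrix (SB ⊕ Fin 2) (SB ⊕ Fin 2) ℝ}

lemma IsRateMatrix.glue (hQA : IsRateMatrix QA) (hQB : IsRateMatrix QB) :
    IsRateMatrix (glue QA QB) where
  nonneg := by
    rintro ((i | i) | f) ((j | j) | g) hij
    · exact hQA.nonneg _ _ (by simpa using hij)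
    · exact le_rfl
    · exact hQA.nonneg _ _ (by simp)
    · exact le_rfl
    · exact hQB.nonneg _ _ (by simpa using hij)
    · exact hQB.nonneg _ _ (by simp)
    · exact hQA.nonneg _ _ (by simp)
    · exact hQB.nonneg _ _ (by simp)
    · exact add_nonneg (hQA.nonneg _ _ (by simpa using hij)) (hQB.nonneg _ _ (by simpa using hij))
  row_sum := by
    rintro ((i | i) | f)
    · have := hQA.row_sum (.inl i)
      simpa [Fintype.sum_sum_type, GluedChain.glue] using this
    · have := hQB.row_sum (.inl i)
      simpa [Fintype.sum_sum_type, GluedChain.glue] using this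
    · have h1 := hQA.row_sum (.inr f)
      have h2 := hQB.row_sum (.inr f)
      simp only [Fintype.sum_sum_type, GluedChain.glue, Finset.sum_add_distrib] at h1 h2 ⊢
      linarith

lemma isIrreducible_glue (hQA : IsRateMatrix QA) (hQB : IsRateMatrix QB)
    (hA : IsIrreducible QA) (hB : IsIrreducible QB) : IsIrreducible (glue QA QB) := by
  have liftA : ∀ i j : SA ⊕ Fin 2, Relation.ReflTransGen
      (fun a b => a ≠ b ∧ 0 < glue QA QB a b) (i.map .inl id) (j.map .inl id) := by
    intro i j
    refine (hA i j).lift _ ?_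
    rintro (a | a) (b | b) ⟨hab, hpos⟩
    · exact ⟨by simpa using hab, hpos⟩
    · exact ⟨by simp, hpos⟩
    · exact ⟨by simp, hpos⟩
    · exact ⟨by simpa using hab, add_pos_of_pos_of_nonneg hpos
        (hQB.nonneg _ _ (by simpa using hab))⟩
  have liftB : ∀ i j : SB ⊕ Fin 2, Relation.ReflTransGen
      (fun a b => a ≠ b ∧ 0 < glue QA QB a b) (i.map .inr id) (j.map .inr id) := by
    intro i j
    refine (hB i j).lift _ ?_
    rintro (a | a) (b | b) ⟨hab, hpos⟩
    · exact ⟨by simpa using hab, hpos⟩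
    · exact ⟨by simp, hpos⟩
    · exact ⟨by simp, hpos⟩
    · exact ⟨by simpa using hab, add_pos_of_nonneg_of_pos
        (hQA.nonneg _ _ (by simpa using hab)) hpos⟩
  have to0 : ∀ i, Relation.ReflTransGen (fun a b => a ≠ b ∧ 0 < glue QA QB a b) i (.inr 0) := by
    rintro ((i | i) | f)
    · exact liftA (.inl i) (.inr 0)
    · exact liftB (.inl i) (.inr 0)
    · exact liftA (.inr f) (.inr 0)
  have from0 : ∀ i, Relation.ReflTransGen (fun a b => a ≠ b ∧ 0 < glue QA QB a b) (.inr 0) i := by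
    rintro ((i | i) | f)
    · exact liftA (.inr 0) (.inl i)
    · exact liftB (.inr 0) (.inl i)
    · exact liftA (.inr 0) (.inr f)
  exact fun i j => (to0 i).trans (from0 j)

/-- The formulas and bounds for one of the two parts of the glued chain. Here `p` is the
restriction of the stationary distribution of the glued chain to the states of that part, and `q`
is the stationary distribution of the part itself. -/
lemma formulas_and_bounds {Q : Matrix (S ⊕ Fin 2) (S ⊕ Fin 2) ℝ} (hQ : IsRateMatrix Q)
    (hirr : IsIrreducible Q) {v : Fin 2 → S → ℝ} (hv : ∀ e, IsExcursionSolution Q e (v e))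
    {p q : S ⊕ Fin 2 → ℝ} (hq : IsStationary Q q)
    (hp : ∀ k : S, ∑ i, p i * Q i (.inl k) = 0)
    (hne : q (.inr 1) * p (.inr 0) - p (.inr 1) * q (.inr 0) ≠ 0) (k : S) :
    (v 0 k = (q (.inr 1) * p (.inl k) - p (.inr 1) * q (.inl k)) /
        (q (.inr 1) * p (.inr 0) - p (.inr 1) * q (.inr 0)) ∧
      v 1 k = (q (.inr 0) * p (.inl k) - p (.inr 0) * q (.inl k)) /
        (q (.inr 0) * p (.inr 1) - p (.inr 0) * q (.inr 1))) ∧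
    (min (p (.inr 0) / q (.inr 0)) (p (.inr 1) / q (.inr 1)) ≤ p (.inl k) / q (.inl k) ∧
      p (.inl k) / q (.inl k) ≤ max (p (.inr 0) / q (.inr 0)) (p (.inr 1) / q (.inr 1))) := by
  have hpos := hq.pos hQ hirr
  have hpk := eq_add_of_balance hQ hirr hv hp k
  have hqk := eq_add_of_balance hQ hirr hv (fun k => congrFun hq.vecMul_eq_zero (.inl k)) k
  have hne' : q (.inr 0) * p (.inr 1) - p (.inr 0) * q (.inr 1) ≠ 0 := fun h =>
    hne (by linarith)
  have hv0 := (hv 0).nonneg k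
  have hv1 := (hv 1).nonneg k
  refine ⟨⟨?_, ?_⟩, ?_, ?_⟩
  · rw [eq_div_iff hne, hpk, hqk]; ring
  · rw [eq_div_iff hne', hpk, hqk]; ring
  · rw [le_div_iff₀ (hpos _), hpk, hqk]
    have h0 := (le_div_iff₀ (hpos (.inr 0))).1
      (min_le_left (p (.inr 0) / q (.inr 0)) (p (.inr 1) / q (.inr 1)))
    have h1 := (le_div_iff₀ (hpos (.inr 1))).1
      (min_le_right (p (.inr 0) / q (.inr 0)) (p (.inr 1) / q (.inr 1)))
    have h0' := mul_le_mul_of_nonneg_right h0 hv0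
    have h1' := mul_le_mul_of_nonneg_right h1 hv1
    linarith
  · rw [div_le_iff₀ (hpos _), hpk, hqk]
    have h0 := (div_le_iff₀ (hpos (.inr 0))).1
      (le_max_left (p (.inr 0) / q (.inr 0)) (p (.inr 1) / q (.inr 1)))
    have h1 := (div_le_iff₀ (hpos (.inr 1))).1
      (le_max_right (p (.inr 0) / q (.inr 0)) (p (.inr 1) / q (.inr 1)))
    have h0' := mul_le_mul_of_nonneg_right h0 hv0
    have h1' := mul_le_mul_of_nonneg_right h1 hv1
    linarith

/-- The ratio of a stationary distribution at the two distinguished states is the ratio of the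
effective rates between them. -/
lemma IsStationary.div_eq {Q : Matrix (S ⊕ Fin 2) (S ⊕ Fin 2) ℝ} (hQ : IsRateMatrix Q)
    (hirr : IsIrreducible Q) {v : Fin 2 → S → ℝ} (hv : ∀ e, IsExcursionSolution Q e (v e))
    {q : S ⊕ Fin 2 → ℝ} (hq : IsStationary Q q) :
    q (.inr 0) / q (.inr 1) = effectiveRate Q 1 0 (v 1) / effectiveRate Q 0 1 (v 0) := by
  have h1 := flux_eq hQ hirr hv (fun k => congrFun hq.vecMul_eq_zero (.inl k)) 1
  have h2 : ∑ i, q i * Q i (.inr 1) = 0 := congrFun hq.vecMul_eq_zero (.inr 1)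
  have h3 := (hv 1).effectiveRate_add hQ
  rw [div_eq_div_iff (hq.pos hQ hirr _).ne'
    ((hv 0).effectiveRate_pos hQ hirr (by decide)).ne']
  linear_combination -h1 + h2 - q (.inr 1) * h3

end Glued

lemma mediant_strictly_between {a b c d : ℝ} (hb : 0 < b) (hd : 0 < d) (h : a / b ≠ c / d) :
    min (a / b) (c / d) < (a + c) / (b + d) ∧ (a + c) / (b + d) < max (a / b) (c / d) := by
  rcases lt_or_gt_of_ne h with h | h
  · have h' := (div_lt_div_iff₀ hb hd).1 h
    rw [min_eq_left h.le, max_eq_right h.le, div_lt_div_iff₀ hb (by positivity),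
      div_lt_div_iff₀ (by positivity) hd]
    constructor <;> linarith
  · have h' := (div_lt_div_iff₀ hd hb).1 h
    rw [min_eq_right h.le, max_eq_left h.le, div_lt_div_iff₀ hd (by positivity),
      div_lt_div_iff₀ (by positivity) hb]
    constructor <;> linarith

end GluedChain

theorem theorem3 {SA SB ΩA ΩB : Type*} [Fintype SA] [Fintype SB]
    [MeasurableSpace ΩA] [MeasurableSpace ΩB]
    (QA : Matrix (SA ⊕ Fin 2) (SA ⊕ Fin 2) ℝ) (QB : Matrix (SB ⊕ Fin 2) (SB ⊕ Fin 2) ℝ)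
    (hQA : GluedChain.IsRateMatrix QA) (hQB : GluedChain.IsRateMatrix QB)
    (hirrA : GluedChain.IsIrreducible QA) (hirrB : GluedChain.IsIrreducible QB)
    (PA : Fin 2 → MeasureTheory.Measure ΩA) (XA : ℝ≥0 → ΩA → SA ⊕ Fin 2)
    (hXA : ∀ e, GluedChain.IsMarkovJumpProcess QA (Sum.inr e) (PA e) XA)
    (PB : Fin 2 → MeasureTheory.Measure ΩB) (XB : ℝ≥0 → ΩB → SB ⊕ Fin 2)
    (hXB : ∀ e, GluedChain.IsMarkovJumpProcess QB (Sum.inr e) (PB e) XB)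
    (πA : SA ⊕ Fin 2 → ℝ) (πB : SB ⊕ Fin 2 → ℝ) (π : (SA ⊕ SB) ⊕ Fin 2 → ℝ)
    (hπA : GluedChain.IsStationary QA πA) (hπB : GluedChain.IsStationary QB πB)
    (hπ : GluedChain.IsStationary (GluedChain.glue QA QB) π)
    (hA : πA (.inr 0) / πA (.inr 1) ≠ πB (.inr 0) / πB (.inr 1)) :
    -- the denominators below do not vanish
    (πA (.inr 1) * π (.inr 0) - π (.inr 1) * πA (.inr 0) ≠ 0 ∧
      πA (.inr 0) * π (.inr 1) - π (.inr 0) * πA (.inr 1) ≠ 0 ∧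
      πB (.inr 1) * π (.inr 0) - π (.inr 1) * πB (.inr 0) ≠ 0 ∧
      πB (.inr 0) * π (.inr 1) - π (.inr 0) * πB (.inr 1) ≠ 0) ∧
    -- the formulas for `v` and `w`
    (∀ i : SA,
      (GluedChain.excursionWeight QA PA XA 0 i ≠ ⊤ ∧
        (GluedChain.excursionWeight QA PA XA 0 i).toReal =
          (πA (.inr 1) * π (.inl (.inl i)) - π (.inr 1) * πA (.inl i)) /
            (πA (.inr 1) * π (.inr 0) - π (.inr 1) * πA (.inr 0))) ∧
      (GluedChain.excursionWeight QA PA XA 1 i ≠ ⊤ ∧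
        (GluedChain.excursionWeight QA PA XA 1 i).toReal =
          (πA (.inr 0) * π (.inl (.inl i)) - π (.inr 0) * πA (.inl i)) /
            (πA (.inr 0) * π (.inr 1) - π (.inr 0) * πA (.inr 1)))) ∧
    -- the formulas for `x` and `y`
    (∀ j : SB,
      (GluedChain.excursionWeight QB PB XB 0 j ≠ ⊤ ∧
        (GluedChain.excursionWeight QB PB XB 0 j).toReal =
          (πB (.inr 1) * π (.inl (.inr j)) - π (.inr 1) * πB (.inl j)) /
            (πB (.inr 1) * π (.inr 0) - π (.inr 1) * πB (.inr 0))) ∧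
      (GluedChain.excursionWeight QB PB XB 1 j ≠ ⊤ ∧
        (GluedChain.excursionWeight QB PB XB 1 j).toReal =
          (πB (.inr 0) * π (.inl (.inr j)) - π (.inr 0) * πB (.inl j)) /
            (πB (.inr 0) * π (.inr 1) - π (.inr 0) * πB (.inr 1)))) ∧
    -- the bounds on the two sets of remaining states
    (∀ i : SA,
      min (π (.inr 0) / πA (.inr 0)) (π (.inr 1) / πA (.inr 1)) ≤ π (.inl (.inl i)) / πA (.inl i) ∧
      π (.inl (.inl i)) / πA (.inl i) ≤
        max (π (.inr 0) / πA (.inr 0)) (π (.inr 1) / πA (.inr 1))) ∧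
    (∀ j : SB,
      min (π (.inr 0) / πB (.inr 0)) (π (.inr 1) / πB (.inr 1)) ≤ π (.inl (.inr j)) / πB (.inl j) ∧
      π (.inl (.inr j)) / πB (.inl j) ≤
        max (π (.inr 0) / πB (.inr 0)) (π (.inr 1) / πB (.inr 1))) ∧
    -- the strict bounds on the ratio at the two glued states
    (min (πA (.inr 0) / πA (.inr 1)) (πB (.inr 0) / πB (.inr 1)) < π (.inr 0) / π (.inr 1) ∧
      π (.inr 0) / π (.inr 1) <
        max (πA (.inr 0) / πA (.inr 1)) (πB (.inr 0) / πB (.inr 1))) := by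
  have hvA := fun e => (hXA e).excursionWeight_ne_top_and_isExcursionSolution hQA hirrA hπA
  have hvB := fun e => (hXB e).excursionWeight_ne_top_and_isExcursionSolution hQB hirrB hπB
  have hsA := fun e => (hvA e).2
  have hsB := fun e => (hvB e).2
  have hpos := hπ.pos (hQA.glue hQB) (GluedChain.isIrreducible_glue hQA hQB hirrA hirrB)
  have hposA := hπA.pos hQA hirrA
  have hposB := hπB.pos hQB hirrB
  -- the restrictions of `π` to the two parts
  set pA : SA ⊕ Fin 2 → ℝ := Sum.elim (fun i => π (.inl (.inl i))) (fun f => π (.inr f)) with hpA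
  set pB : SB ⊕ Fin 2 → ℝ := Sum.elim (fun j => π (.inl (.inr j))) (fun f => π (.inr f)) with hpB
  have hbal : ∀ k, ∑ i, π i * GluedChain.glue QA QB i k = 0 := fun k =>
    congrFun hπ.vecMul_eq_zero k
  have hbalA : ∀ k : SA, ∑ i, pA i * QA i (.inl k) = 0 := fun k => by
    simpa [hpA, Fintype.sum_sum_type, GluedChain.glue] using hbal (.inl (.inl k))
  have hbalB : ∀ k : SB, ∑ i, pB i * QB i (.inl k) = 0 := fun k => by
    simpa [hpB, Fintype.sum_sum_type, GluedChain.glue] using hbal (.inl (.inr k))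
  have hflux : ∑ i, pA i * QA i (.inr 1) + ∑ i, pB i * QB i (.inr 1) = 0 := by
    have := hbal (.inr 1)
    simp only [hpA, hpB, Fintype.sum_sum_type, GluedChain.glue, Fin.sum_univ_two, Sum.elim_inl,
      Sum.elim_inr] at this ⊢
    linarith
  rw [GluedChain.flux_eq hQA hirrA hsA hbalA, GluedChain.flux_eq hQB hirrB hsB hbalB] at hflux
  have hA01 := (hsA 0).effectiveRate_pos hQA hirrA (e' := 1) (by decide)
  have hB01 := (hsB 0).effectiveRate_pos hQB hirrB (e' := 1) (by decide)
  have hA1 := (hsA 1).effectiveRate_add hQA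
  have hB1 := (hsB 1).effectiveRate_add hQB
  have hratA := hπA.div_eq hQA hirrA hsA
  have hratB := hπB.div_eq hQB hirrB hsB
  -- `π` balances the sum of the effective rates of the two parts, so its ratio is their mediant
  have hrat : π (.inr 0) / π (.inr 1) =
      (GluedChain.effectiveRate QA 1 0 (fun k => (GluedChain.excursionWeight QA PA XA 1 k).toReal) +
        GluedChain.effectiveRate QB 1 0
          (fun k => (GluedChain.excursionWeight QB PB XB 1 k).toReal)) /
      (GluedChain.effectiveRate QA 0 1 (fun k => (GluedChain.excursionWeight QA PA XA 0 k).toReal) +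
        GluedChain.effectiveRate QB 0 1
          (fun k => (GluedChain.excursionWeight QB PB XB 0 k).toReal)) := by
    rw [div_eq_div_iff (hpos _).ne' (add_pos hA01 hB01).ne']
    simp only [hpA, hpB, Sum.elim_inr] at hflux
    linear_combination hflux - π (.inr 1) * hA1 - π (.inr 1) * hB1
  have hmed := GluedChain.mediant_strictly_between hA01 hB01 (hratA ▸ hratB ▸ hA)
  rw [← hrat, ← hratA, ← hratB] at hmed
  have hneA : π (.inr 0) / π (.inr 1) ≠ πA (.inr 0) / πA (.inr 1) := fun h => by
    rw [h] at hmed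
    rcases le_total (πA (.inr 0) / πA (.inr 1)) (πB (.inr 0) / πB (.inr 1)) with h' | h'
    · exact absurd hmed.1 (by rw [min_eq_left h']; exact lt_irrefl _)
    · exact absurd hmed.2 (by rw [max_eq_left h']; exact lt_irrefl _)
  have hneB : π (.inr 0) / π (.inr 1) ≠ πB (.inr 0) / πB (.inr 1) := fun h => by
    rw [h] at hmed
    rcases le_total (πA (.inr 0) / πA (.inr 1)) (πB (.inr 0) / πB (.inr 1)) with h' | h'
    · exact absurd hmed.2 (by rw [max_eq_right h']; exact lt_irrefl _)
    · exact absurd hmed.1 (by rw [min_eq_right h']; exact lt_irrefl _)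
  have hdA : πA (.inr 1) * π (.inr 0) - π (.inr 1) * πA (.inr 0) ≠ 0 := fun h =>
    hneA ((div_eq_div_iff (hpos _).ne' (hposA _).ne').2 (by linarith))
  have hdB : πB (.inr 1) * π (.inr 0) - π (.inr 1) * πB (.inr 0) ≠ 0 := fun h =>
    hneB ((div_eq_div_iff (hpos _).ne' (hposB _).ne').2 (by linarith))
  have keyA := GluedChain.formulas_and_bounds hQA hirrA hsA hπA hbalA hdA
  have keyB := GluedChain.formulas_and_bounds hQB hirrB hsB hπB hbalB hdB
  exact ⟨⟨hdA, fun h => hdA (by linarith), hdB, fun h => hdB (by linarith)⟩,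
    fun i => ⟨⟨(hvA 0).1 i, (keyA i).1.1⟩, (hvA 1).1 i, (keyA i).1.2⟩,
    fun j => ⟨⟨(hvB 0).1 j, (keyB j).1.1⟩, (hvB 1).1 j, (keyB j).1.2⟩,
    fun i => (keyA i).2, fun j => (keyB j).2, hmed⟩
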